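/- Let $a>0$ be real, let $\nu\in\mathbb C$ with $\operatorname{Re}\nu>0$, $\nu\ne1,2,\dots$, put $\nu_0=\nu^2-\tfrac14$, and let $A=[a_{jk}]_{j,k=1,2}$ be a complex matrix with $\det A\ne0$. Let $q$ be a complex-valued function such that, for some $T>a$, $q(x)|x-a|^{\min(0,1-2\operatorname{Re}\nu)}\in L(0,T)$ and $q\in L(T,\infty)$. Consider the equation $$-y''+\Big(\frac{\nu_0}{(x-a)^2}+q(x)\Big)y=\lambda y,\qquad x\ge 0,\ x\neq a. \tag{1}$$ Let $\mu_j=(-1)^j\nu+\tfrac12$, let $c_{10},c_{20}\in\mathbb C$ with $c_{10}c_{20}=(2\nu)^{-1}$, and, for $j=1,2$, put $$c_{jk}=(-1)^kc_{j0}\Big(\prod_{s=1}^k\big((2s+\mu_j)(2s+\mu_j-1)-\nu_0\big)\Big)^{-1},\qquad C_j(x,\lambda)=(x-a)^{\mu_j}\sum_{k\ge0}c_{jk}\lambda^k(x-a)^{2k},$$ with the principal branch of the power, $\arg\in(-\pi,\pi]$. Let $s_j(x,\lambda)$ be the solution of $$s_j(x,\lambda)=C_j(x,\lambda)+\int_a^x\big(C_1(t,\lambda)C_2(x,\lambda)-C_1(x,\lambda)C_2(t,\lambda)\big)q(t)s_j(t,\lambda)\,dt$$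 for $0\le x<a$ and for $x>a$. Put $\sigma_j=s_j$ for $x<a$ and $\sigma_j=\sum_{k=1}^2a_{kj}s_k$ for $x>a$, and $$\varphi(x,\lambda)=\sigma_1(0,\lambda)\sigma_2(x,\lambda)-\sigma_2(0,\lambda)\sigma_1(x,\lambda).$$ For $\operatorname{Im}\rho>0$ let $e(x,\rho)=\sum_{k=1}^2A_k(\rho)\sigma_k(x,\rho^2)$ be the Jost solution, determined by $\lim_{x\to\infty}e(x,\rho)e^{-i\rho x}=1$, and let $\Delta(\rho)=e(0,\rho)$. A number $\lambda\in\mathbb C$ is called an eigenvalue of the boundary value problem $\mathcal L$ if (1) has a nontrivial solution of the form $y=\alpha_1\sigma_1(x,\lambda)+\alpha_2\sigma_2(x,\lambda)$ with $y(0)=0$ and $\lim_{x\to\infty}y(x)=0$. Then the set $\Lambda'=\{\lambda=\rho^2:\ \operatorname{Im}\rho>0,\ \Delta(\rho)=0\}$ coincides with the set of nonzero eigenvalues of $\mathcal L$. Moreover, for every $\rho_k$ with $\operatorname{Im}\rho_k>0$ and $\lambda_k=\rho_k^2\in\Lambda'$ there is $\beta_k\ne0$ such that $e(x,\rho_k)=\beta_k\varphi(x,\lambda_k)$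 for all $x\ge0$, $x\ne a$. -/

import Mathlib

open MeasureTheory Filter Topology

noncomputable section

/-- The data of the boundary value problem `-y'' + (ν₀ / (x - a)² + q(x)) y = λ y` on the half-line
with `ν₀ = ν² - 1/4`, Dirichlet condition at `0` and transition matrix `A` at the point `a`.
The numbers `c 0`, `c 1` are the leading coefficients of the two Bessel-type solutions of the
equation with `q = 0`. Indices `1, 2` are written `0, 1 : Fin 2`. -/
structure BesselSL where
  a : ℝ
  ν : ℂ
  c : Fin 2 → ℂ
  A : Matrix (Fin 2) (Fin 2) ℂ
  q : ℝ → ℂ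

namespace BesselSL

/-- `ν₀ = ν² - 1/4`. -/
def ν₀ (P : BesselSL) : ℂ := P.ν ^ 2 - 1 / 4

/-- The half-line `x ≥ 0` without the singular point `a`. -/
def domain (P : BesselSL) : Set ℝ := {x | 0 ≤ x ∧ x ≠ P.a}

/-- The class of potentials: `q(x) |x - a| ^ min(0, 1 - 2 Re ν)` is integrable on `(0, T)` for some
`T > a`, and `q` is integrable on `(T, ∞)`. -/
def PotentialClass (P : BesselSL) : Prop :=
  ∃ T : ℝ, P.a < T ∧
    IntegrableOn (fun x => P.q x * ((|x - P.a| ^ min 0 (1 - 2 * P.ν.re) : ℝ) : ℂ))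
      (Set.Ioo 0 T) ∧
    IntegrableOn P.q (Set.Ioi T)

/-- The exponents `μ₁ = 1/2 - ν`, `μ₂ = 1/2 + ν`. -/
def μ (P : BesselSL) (j : Fin 2) : ℂ := (-1) ^ ((j : ℕ) + 1) * P.ν + 1 / 2

/-- The coefficients `c_{jk}`. -/
def coeff (P : BesselSL) (j : Fin 2) (k : ℕ) : ℂ :=
  (-1) ^ k * P.c j *
    (∏ s ∈ Finset.Icc 1 k, ((2 * (s : ℂ) + P.μ j) * (2 * (s : ℂ) + P.μ j - 1) - P.ν₀))⁻¹

/-- `C_j(x, λ) = (x - a)^{μ_j} ∑ₖ c_{jk} (ρ (x - a))^{2k}`, where `λ = ρ²`, with the principal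
branch of the power (`arg ∈ (-π, π]`). -/
def C (P : BesselSL) (j : Fin 2) (x : ℝ) (lam : ℂ) : ℂ :=
  ((x - P.a : ℝ) : ℂ) ^ P.μ j * ∑' k : ℕ, P.coeff j k * (lam * ((x - P.a : ℝ) : ℂ) ^ 2) ^ k

/-- The kernel `g(x, t, λ) = C₁(t, λ) C₂(x, λ) - C₁(x, λ) C₂(t, λ)`. -/
def g (P : BesselSL) (x t : ℝ) (lam : ℂ) : ℂ :=
  P.C 0 t lam * P.C 1 x lam - P.C 0 x lam * P.C 1 t lam

/-- `f` solves the integral equation `f(x) = C_j(x, λ) + ∫ₐˣ g(x, t, λ) q(t) f(t) dt` on both sides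
of the point `a`, with absolutely convergent integrals. -/
def IsIntegralSolution (P : BesselSL) (j : Fin 2) (lam : ℂ) (f : ℝ → ℂ) : Prop :=
  ∀ x ∈ P.domain,
    IntervalIntegrable (fun t => P.g x t lam * P.q t * f t) volume P.a x ∧
    f x = P.C j x lam + ∫ t in P.a..x, P.g x t lam * P.q t * f t

/-- `s_j(x, λ)`, the solution of the integral equation. -/
def s (P : BesselSL) (j : Fin 2) (x : ℝ) (lam : ℂ) : ℂ :=
  Classical.epsilon (fun f : ℝ → ℂ => P.IsIntegralSolution j lam f) x

/-- `σ_j(x, λ)`: it is `s_j` to the left of `a` and `∑ₖ a_{kj} s_k` to the right of `a`. -/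
def σ (P : BesselSL) (j : Fin 2) (x : ℝ) (lam : ℂ) : ℂ :=
  if x < P.a then P.s j x lam else ∑ k, P.A k j * P.s k x lam

/-- The solution `φ(x, λ) = σ₁(0, λ) σ₂(x, λ) - σ₂(0, λ) σ₁(x, λ)`. -/
def φ (P : BesselSL) (x : ℝ) (lam : ℂ) : ℂ :=
  P.σ 0 0 lam * P.σ 1 x lam - P.σ 1 0 lam * P.σ 0 x lam

/-- The linear combination `α₁ σ₁(x, λ) + α₂ σ₂(x, λ)`. -/
def comb (P : BesselSL) (α : Fin 2 → ℂ) (x : ℝ) (lam : ℂ) : ℂ := ∑ k, α k * P.σ k x lam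

/-- The coefficients `A_k(ρ)` of the Jost solution: those for which
`∑ₖ A_k(ρ) σ_k(x, ρ²) exp(-iρx) → 1` as `x → ∞`. -/
def jostCoeff (P : BesselSL) (ρ : ℂ) : Fin 2 → ℂ :=
  Classical.epsilon (fun α : Fin 2 → ℂ =>
    Tendsto (fun x : ℝ => P.comb α x (ρ ^ 2) * Complex.exp (-(Complex.I * ρ * (x : ℂ))))
      atTop (𝓝 1))

/-- The discontinuous Jost solution `e(x, ρ)`. -/
def e (P : BesselSL) (x : ℝ) (ρ : ℂ) : ℂ := P.comb (P.jostCoeff ρ) x (ρ ^ 2)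

/-- The characteristic function `Δ(ρ) = e(0, ρ)`. -/
def Δ (P : BesselSL) (ρ : ℂ) : ℂ := P.e 0 ρ

/-- `Λ' = {λ = ρ² : Im ρ > 0, Δ(ρ) = 0}`. -/
def Λ' (P : BesselSL) : Set ℂ := {lam | ∃ ρ : ℂ, 0 < ρ.im ∧ P.Δ ρ = 0 ∧ lam = ρ ^ 2}

/-- `y` is a (Carathéodory) solution of `-y'' + (ν₀ / (x - a)² + q(x)) y = λ y` for `x ≥ 0`,
`x ≠ a`: it is differentiable there, and its derivative is locally absolutely continuous with
`y'' = (ν₀ / (x - a)² + q(x) - λ) y` almost everywhere, on each side of `a`. -/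
def IsSolution (P : BesselSL) (lam : ℂ) (y : ℝ → ℂ) : Prop :=
  ∃ y' : ℝ → ℂ,
    (∀ x ∈ P.domain, HasDerivWithinAt y (y' x) (Set.Ici 0) x) ∧
    ∀ u v : ℝ, u ≤ v → Set.Icc u v ⊆ P.domain →
      IntervalIntegrable
        (fun t => (P.ν₀ / ((t - P.a : ℝ) : ℂ) ^ 2 + P.q t - lam) * y t) volume u v ∧
      y' v - y' u = ∫ t in u..v, (P.ν₀ / ((t - P.a : ℝ) : ℂ) ^ 2 + P.q t - lam) * y t

/-- `λ` is an eigenvalue: the equation has a nontrivial solution `y = α₁ σ₁ + α₂ σ₂` with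
`y(0) = 0` and `y(x) → 0` as `x → ∞`. -/
def IsEigenvalue (P : BesselSL) (lam : ℂ) : Prop :=
  ∃ α : Fin 2 → ℂ,
    P.IsSolution lam (fun x => P.comb α x lam) ∧
    (∃ x ∈ P.domain, P.comb α x lam ≠ 0) ∧
    P.comb α 0 lam = 0 ∧
    Tendsto (fun x => P.comb α x lam) atTop (𝓝 0)

end BesselSL

end

/-! Everything rests on the two-dimensionality of the solution space on each side of `a`, expressed
through Wronskians. Variation of constants writes s_j = u C₁ + v C₂, where (u, v) solves a linear
system with coefficients q C_i C_k. The bound on C_j in `exists_norm_C_le` matches the weight in the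
class of q, so these coefficients are integrable across `a`; Picard iteration solves the system, and
its trace is zero, so s₁, s₂ have Wronskian 1 on both sides (`exists_s_eq`,
`exists_isSolutionOn_s`). As `s` is a choice among solutions of an integral equation, uniqueness
(`IsIntegralSolution.unique`) is needed to transfer this to it.

Near infinity the potential ν₀/(x-a)² + q is integrable, and a contraction argument gives a solution
asymptotic to exp(iρx) for all ρ ≠ 0 with Im ρ ≥ 0 (`exists_jostSolution`). Since the Wronskian of
s₁, s₂ is 1 and A is invertible, it extends to a combination of σ₁, σ₂ (`exists_jostCoeff`). A
combination that tends to 0 has zero Wronskian with it, hence is a multiple of it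
(`exists_eq_smul_of_tendsto_zero`).

If Δ(ρ) = 0, then e(·, ρ) decays and is an eigenfunction. Conversely, write a nonzero eigenvalue as
ρ² with Im ρ ≥ 0; its eigenfunction is a multiple of the Jost solution. For real ρ that solution has
modulus tending to 1, so the multiple would be zero; for Im ρ > 0 the condition at 0 gives Δ(ρ) = 0.
Finally e and φ both vanish at 0, and the Wronskian at 0 excludes σ₁(0) = σ₂(0) = 0, so the
combinations vanishing at 0 form a line. -/

noncomputable section

/-! ### Calculus of indefinite integrals -/

/-- `F` is on `S` an indefinite integral of `f`. -/
def IsPrimitiveOn {E : Type*} [NormedAddCommGroup E] [NormedSpace ℝ E] (S : Set ℝ) (F f : ℝ → E) :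
    Prop :=
  ∀ u ∈ S, ∀ v ∈ S, IntervalIntegrable f volume u v ∧ F v - F u = ∫ t in u..v, f t

namespace IsPrimitiveOn

section general
variable {E : Type*} [NormedAddCommGroup E] [NormedSpace ℝ E] {S T : Set ℝ} {F G f g : ℝ → E}

theorem mono (h : IsPrimitiveOn S F f) (hT : T ⊆ S) : IsPrimitiveOn T F f :=
  fun u hu v hv => h u (hT hu) v (hT hv)

theorem add (hF : IsPrimitiveOn S F f) (hG : IsPrimitiveOn S G g) :
    IsPrimitiveOn S (fun x => F x + G x) (fun x => f x + g x) := by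
  intro u hu v hv
  obtain ⟨h1, h2⟩ := hF u hu v hv
  obtain ⟨h3, h4⟩ := hG u hu v hv
  refine ⟨h1.add h3, ?_⟩
  rw [intervalIntegral.integral_add h1 h3, ← h2, ← h4, add_sub_add_comm]

theorem congr (hF : IsPrimitiveOn S F f) (hS : S.OrdConnected) (hG : ∀ x ∈ S, G x = F x)
    (hg : ∀ x ∈ S, g x = f x) : IsPrimitiveOn S G g := by
  intro u hu v hv
  obtain ⟨h1, h2⟩ := hF u hu v hv
  have hsub : Set.uIcc u v ⊆ S := hS.uIcc_subset hu hv
  refine ⟨h1.congr fun t ht => (hg t (hsub (Set.uIoc_subset_uIcc ht))).symm, ?_⟩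
  rw [hG u hu, hG v hv, h2]
  exact intervalIntegral.integral_congr fun t ht => (hg t (hsub ht)).symm

theorem continuousOn_uIcc (hF : IsPrimitiveOn S F f) {u v : ℝ} (hu : u ∈ S) (hv : v ∈ S)
    (hS : S.OrdConnected) : ContinuousOn F (Set.uIcc u v) := by
  have h1 := intervalIntegral.continuousOn_primitive_interval' (hF u hu v hv).1
    (Set.left_mem_uIcc : u ∈ Set.uIcc u v)
  refine (continuousOn_const.add h1 (f := fun _ => F u)).congr fun x hx => ?_
  simp only [Pi.add_apply]
  rw [← (hF u hu x (hS.uIcc_subset hu hv hx)).2, add_sub_cancel]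

/-- Increments of `F` are dominated by those of the primitive of `‖f‖`, so absolute continuity of
that real function passes to `F`. -/
theorem absolutelyContinuousOnInterval (hF : IsPrimitiveOn S F f) {u v : ℝ} (hu : u ∈ S)
    (hv : v ∈ S) (hS : S.OrdConnected) : AbsolutelyContinuousOnInterval F u v := by
  have hsub : Set.uIcc u v ⊆ S := hS.uIcc_subset hu hv
  have hi := (hF u hu v hv).1.norm
  have key := hi.absolutelyContinuousOnInterval_intervalIntegral (Set.left_mem_uIcc : u ∈ _)
  rw [absolutelyContinuousOnInterval_iff] at key ⊢
  intro ε hε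
  obtain ⟨δ, hδ, h⟩ := key ε hε
  refine ⟨δ, hδ, fun E hE hE' => lt_of_le_of_lt (Finset.sum_le_sum fun i hi' => ?_) (h E hE hE')⟩
  obtain ⟨h1, h2⟩ := hE.1 i hi'
  have e := (hF _ (hsub h2) _ (hsub h1)).2
  rw [dist_eq_norm, e, Real.dist_eq, intervalIntegral.integral_interval_sub_left
    (hi.mono_set (Set.uIcc_subset_uIcc_left h1)) (hi.mono_set (Set.uIcc_subset_uIcc_left h2))]
  exact intervalIntegral.norm_integral_le_abs_integral_norm

end general

variable {𝕜 : Type*} [RCLike 𝕜] {S : Set ℝ} {F G f g : ℝ → 𝕜}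

theorem const_mul (c : 𝕜) (hF : IsPrimitiveOn S F f) :
    IsPrimitiveOn S (fun x => c * F x) (fun x => c * f x) := by
  intro u hu v hv
  obtain ⟨h1, h2⟩ := hF u hu v hv
  refine ⟨h1.const_mul c, ?_⟩
  rw [intervalIntegral.integral_const_mul, ← h2]
  ring

/-- The product rule for indefinite integrals. -/
theorem mul (hF : IsPrimitiveOn S F f) (hG : IsPrimitiveOn S G g) (hS : S.OrdConnected) :
    IsPrimitiveOn S (fun x => F x * G x) (fun x => f x * G x + F x * g x) := by
  intro u hu v hv
  have hfi := (hF u hu v hv).1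
  have hgi := (hG u hu v hv).1
  have hi : IntervalIntegrable (fun x => f x * G x + F x * g x) volume u v :=
    (hfi.mul_continuousOn (hG.continuousOn_uIcc hu hv hS)).add
      (hgi.continuousOn_mul (hF.continuousOn_uIcc hu hv hS))
  refine ⟨hi, ?_⟩
  -- The difference of `F * G` and the candidate integral is absolutely continuous with derivative
  -- zero almost everywhere, hence constant.
  have hac := ((hF.absolutelyContinuousOnInterval hu hv hS).smul
    (hG.absolutelyContinuousOnInterval hu hv hS)).sub
    (absolutelyContinuousOnInterval (S := Set.uIcc u v)
      (F := fun x => ∫ t in u..x, f t * G t + F t * g t) (fun x hx y hy => ⟨hi.mono_set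
      (Set.uIcc_subset_uIcc hx hy), intervalIntegral.integral_interval_sub_left
      (hi.mono_set (Set.uIcc_subset_uIcc_left hy)) (hi.mono_set (Set.uIcc_subset_uIcc_left hx))⟩)
      Set.left_mem_uIcc Set.right_mem_uIcc Set.ordConnected_uIcc)
  obtain ⟨C, hC⟩ := hac.const_of_ae_hasDerivAt_zero (by
    have hne : ∀ w : ℝ, ∀ᵐ x : ℝ, x ≠ w := fun w => by simp [ae_iff, measure_singleton]
    filter_upwards [hfi.ae_hasDerivAt_integral, hgi.ae_hasDerivAt_integral,
      hi.ae_hasDerivAt_integral, hne u, hne v] with x h1 h2 h3 hxu hxv hx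
    -- Discarding the two endpoints makes `x` interior, so that `F` and `G` agree with their
    -- integral representations in a full neighbourhood.
    have hnhds : Set.uIcc u v ∈ 𝓝 x := by
      rw [Set.uIcc, Icc_mem_nhds_iff]
      rw [Set.uIcc, Set.mem_Icc] at hx
      constructor
      · rcases le_total u v with h | h <;> simp only [h, min_eq_left, min_eq_right] at hx ⊢
        · exact lt_of_le_of_ne hx.1 (Ne.symm hxu)
        · exact lt_of_le_of_ne hx.1 (Ne.symm hxv)
      · rcases le_total u v with h | h <;> simp only [h, max_eq_left, max_eq_right] at hx ⊢
        · exact lt_of_le_of_ne hx.2 hxv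
        · exact lt_of_le_of_ne hx.2 hxu
    have d (H h : ℝ → 𝕜) (hH : IsPrimitiveOn S H h)
        (hd : HasDerivAt (fun x => ∫ t in u..x, h t) (h x) x) : HasDerivAt H (h x) x := by
      refine (hd.const_add (H u)).congr_of_eventuallyEq ?_
      filter_upwards [hnhds] with y hy
      rw [← (hH u hu y (hS.uIcc_subset hu hv hy)).2]
      ring
    have hfd := d F f hF (h1 hx u Set.left_mem_uIcc)
    have hgd := d G g hG (h2 hx u Set.left_mem_uIcc)
    have := (hfd.mul hgd).sub (h3 hx u Set.left_mem_uIcc)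
    simpa using this)
  have e1 := hC u Set.left_mem_uIcc
  have e2 := hC v Set.right_mem_uIcc
  simp only [Pi.sub_apply, Pi.mul_apply, smul_eq_mul, intervalIntegral.integral_same] at e1 e2
  linear_combination e2 - e1

theorem pow (hF : IsPrimitiveOn S F f) (hS : S.OrdConnected) (n : ℕ) :
    IsPrimitiveOn S (fun x => F x ^ (n + 1)) (fun x => (n + 1) * (F x ^ n * f x)) := by
  induction n with
  | zero => simpa using hF
  | succ n ih =>
    refine (ih.mul hF hS).congr hS (fun x _ => pow_succ _ _) fun x _ => ?_
    push_cast
    ring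

theorem of_hasDerivAt (hS : S.OrdConnected) (h : ∀ x ∈ S, HasDerivAt F (f x) x)
    (hf : ContinuousOn f S) : IsPrimitiveOn S F f := by
  intro u hu v hv
  have hsub : Set.uIcc u v ⊆ S := hS.uIcc_subset hu hv
  have hi : IntervalIntegrable f volume u v := (hf.mono hsub).intervalIntegrable
  exact ⟨hi, (intervalIntegral.integral_eq_sub_of_hasDerivAt (fun x hx => h x (hsub hx)) hi).symm⟩

theorem hasDerivWithinAt_Icc (hF : IsPrimitiveOn S F f) (hS : S.OrdConnected) {u v x : ℝ}
    (hu : u ∈ S) (hv : v ∈ S) (hx : x ∈ Set.Icc u v) (hf : ContinuousOn f (Set.Icc u v)) :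
    HasDerivWithinAt F (f x) (Set.Icc u v) x := by
  have huv : u ≤ v := hx.1.trans hx.2
  have hxS : x ∈ S := hS.out hu hv hx
  have : Fact (x ∈ Set.Icc u v) := ⟨hx⟩
  have := intervalIntegral.integral_hasDerivWithinAt_right (hF u hu x hxS).1
    (s := Set.Icc u v) (t := Set.Icc u v)
    (hf.stronglyMeasurableAtFilter_nhdsWithin measurableSet_Icc x) (hf x hx)
  refine (this.const_add (F u)).congr (fun y hy => ?_) ?_
  · rw [← (hF u hu y (hS.out hu hv hy)).2]; ring
  · rw [← (hF u hu x hxS).2]; ring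

end IsPrimitiveOn

/-! ### Linear systems with integrable coefficients -/

section LinearSystem

variable {E : Type*} [NormedAddCommGroup E] [NormedSpace ℂ E]

theorem intervalIntegrable_clm_apply {N : ℝ → E →L[ℂ] E} {φ : ℝ → E} {a x : ℝ}
    (hN : IntervalIntegrable N volume a x) (hφ : ContinuousOn φ (Set.uIcc a x)) :
    IntervalIntegrable (fun t => N t (φ t)) volume a x := by
  obtain ⟨K, hK⟩ := isCompact_uIcc.exists_bound_of_continuousOn hφ
  have hm : AEStronglyMeasurable φ (volume.restrict (Set.uIoc a x)) :=
    (hφ.mono Set.uIoc_subset_uIcc).aestronglyMeasurable measurableSet_uIoc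
  rw [intervalIntegrable_iff] at hN ⊢
  refine (hN.norm.mul_const K).mono' ((ContinuousLinearMap.id ℂ
    (E →L[ℂ] E)).aestronglyMeasurable_comp₂ hN.aestronglyMeasurable hm) ?_
  filter_upwards [ae_restrict_mem measurableSet_uIoc] with t ht
  exact (ContinuousLinearMap.le_opNorm _ _).trans
    (mul_le_mul_of_nonneg_left (hK t (Set.uIoc_subset_uIcc ht)) (norm_nonneg _))

/-- With P the primitive of k vanishing at `a`, P ^ n * k is the derivative of P ^ (n + 1) / (n +
1). To the left of `a` one has P ≤ 0, and the absolute value costs only a factor (-1) ^ n. This is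
the source of the factorials in the Picard bounds on both sides of `a`. -/
theorem abs_integral_mul_abs_pow {k : ℝ → ℝ} {a x : ℝ} (hk : IntervalIntegrable k volume a x)
    (hk0 : ∀ t, 0 ≤ k t) (n : ℕ) :
    IntervalIntegrable (fun t => k t * |∫ s in a..t, k s| ^ n) volume a x ∧
    |∫ t in a..x, k t * |∫ s in a..t, k s| ^ n| = |∫ s in a..x, k s| ^ (n + 1) / (n + 1) := by
  have hP : IsPrimitiveOn (Set.uIcc a x) (fun y => ∫ s in a..y, k s) k := fun u hu v hv =>
    ⟨hk.mono_set (Set.uIcc_subset_uIcc hu hv), intervalIntegral.integral_interval_sub_left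
      (hk.mono_set (Set.uIcc_subset_uIcc_left hv)) (hk.mono_set (Set.uIcc_subset_uIcc_left hu))⟩
  have hc := hP.continuousOn_uIcc Set.left_mem_uIcc Set.right_mem_uIcc Set.ordConnected_uIcc
  refine ⟨hk.mul_continuousOn (hc.abs.pow n), ?_⟩
  have h := (hP.pow Set.ordConnected_uIcc n a Set.left_mem_uIcc x Set.right_mem_uIcc).2
  simp only [intervalIntegral.integral_same, ne_eq, Nat.add_eq_zero_iff, one_ne_zero, and_false,
    not_false_eq_true, zero_pow, sub_zero, intervalIntegral.integral_const_mul] at h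
  have hn : (0 : ℝ) < n + 1 := by positivity
  have h2 : |∫ t in a..x, k t * |∫ s in a..t, k s| ^ n| =
      |∫ t in a..x, (∫ s in a..t, k s) ^ n * k t| := by
    rcases le_total a x with hax | hax
    · congr 1
      refine intervalIntegral.integral_congr fun t ht => ?_
      rw [Set.uIcc_of_le hax] at ht
      rw [abs_of_nonneg (intervalIntegral.integral_nonneg ht.1 fun s _ => hk0 s), mul_comm]
    · have e : ∫ t in a..x, k t * |∫ s in a..t, k s| ^ n =
          ∫ t in a..x, (-1) ^ n * ((∫ s in a..t, k s) ^ n * k t) := by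
        refine intervalIntegral.integral_congr fun t ht => ?_
        rw [Set.uIcc_of_ge hax] at ht
        have hneg : ∫ s in a..t, k s ≤ 0 := by
          rw [intervalIntegral.integral_symm, neg_nonpos]
          exact intervalIntegral.integral_nonneg ht.2 fun s _ => hk0 s
        rw [abs_of_nonpos hneg, neg_pow]
        ring
      rw [e, intervalIntegral.integral_const_mul, abs_mul, abs_pow, abs_neg, abs_one, one_pow,
        one_mul]
  rw [h2, eq_div_iff hn.ne', ← abs_pow, h, abs_mul, abs_of_pos hn, mul_comm]

theorem norm_integral_clm_apply_le {N : ℝ → E →L[ℂ] E} {φ : ℝ → E} {a x B : ℝ} {n : ℕ}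
    (hB : 0 ≤ B) (hN : IntervalIntegrable N volume a x)
    (hφ : ∀ t ∈ Set.uIoc a x, ‖φ t‖ ≤ B * (|∫ s in a..t, ‖N s‖| ^ n / n.factorial)) :
    ‖∫ t in a..x, N t (φ t)‖ ≤ B * (|∫ s in a..x, ‖N s‖| ^ (n + 1) / (n + 1).factorial) := by
  obtain ⟨h1, h2⟩ := abs_integral_mul_abs_pow hN.norm (fun t => norm_nonneg (N t)) n
  calc ‖∫ t in a..x, N t (φ t)‖
      ≤ |∫ t in a..x, B / n.factorial * (‖N t‖ * |∫ s in a..t, ‖N s‖| ^ n)| := by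
        refine intervalIntegral.norm_integral_le_abs_of_norm_le ?_ (h1.const_mul _)
        filter_upwards [ae_restrict_mem measurableSet_uIoc] with t ht
        refine (ContinuousLinearMap.le_opNorm _ _).trans
          ((mul_le_mul_of_nonneg_left (hφ t ht) (norm_nonneg _)).trans (le_of_eq ?_))
        ring
    _ = |B| * (|∫ s in a..x, ‖N s‖| ^ (n + 1) / (n + 1).factorial) := by
        rw [intervalIntegral.integral_const_mul, abs_mul, h2, abs_div, Nat.abs_cast,
          Nat.factorial_succ]
        push_cast
        field_simp
    _ = B * (|∫ s in a..x, ‖N s‖| ^ (n + 1) / (n + 1).factorial) := by rw [abs_of_nonneg hB]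

/-- Feeding a bound for `φ` back into the equation n times gives B * M ^ n / n! with M the absolute
value of the integral of `‖N‖`, and this tends to 0. -/
theorem eq_zero_of_eq_integral_clm_apply {N : ℝ → E →L[ℂ] E} {φ : ℝ → E} {a x : ℝ}
    (hN : IntervalIntegrable N volume a x) (hφ : ContinuousOn φ (Set.uIcc a x))
    (h : ∀ t ∈ Set.uIcc a x, φ t = ∫ s in a..t, N s (φ s)) : φ x = 0 := by
  obtain ⟨B, hB⟩ := isCompact_uIcc.exists_bound_of_continuousOn hφ
  have hB0 : 0 ≤ B := (norm_nonneg _).trans (hB x Set.right_mem_uIcc)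
  have key (n : ℕ) : ∀ t ∈ Set.uIcc a x,
      ‖φ t‖ ≤ B * (|∫ s in a..t, ‖N s‖| ^ n / n.factorial) := by
    induction n with
    | zero => simpa using hB
    | succ n ih =>
      intro t ht
      rw [h t ht]
      refine norm_integral_clm_apply_le hB0 (hN.mono_set (Set.uIcc_subset_uIcc_left ht))
        fun s hs => ih s ?_
      exact Set.uIcc_subset_uIcc_left ht (Set.uIoc_subset_uIcc hs)
  have hlim := (FloorSemiring.tendsto_pow_div_factorial_atTop |∫ s in a..x, ‖N s‖|).const_mul B
  rw [mul_zero] at hlim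
  exact norm_le_zero_iff.1 (ge_of_tendsto' hlim fun n => key n x Set.right_mem_uIcc)

variable [CompleteSpace E]

/-- A linear system with locally integrable coefficients has a global solution. -/
theorem exists_continuous_eq_add_integral_clm_apply {N : ℝ → E →L[ℂ] E}
    (hN : ∀ x y, IntervalIntegrable N volume x y) (a : ℝ) (U₀ : E) :
    ∃ U : ℝ → E, Continuous U ∧ ∀ x, U x = U₀ + ∫ t in a..x, N t (U t) := by
  -- `W n` is the n-th Picard increment, not the n-th iterate; the solution is the sum of the
  -- increments.
  let W : ℕ → ℝ → E := fun n => Nat.rec (fun _ => U₀) (fun _ w x => ∫ t in a..x, N t (w t)) n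
  have hW0 (x : ℝ) : W 0 x = U₀ := rfl
  have hWs (n : ℕ) (x : ℝ) : W (n + 1) x = ∫ t in a..x, N t (W n t) := rfl
  have hWc (n : ℕ) : Continuous (W n) := by
    induction n with
    | zero => exact continuous_const
    | succ n ih =>
      exact intervalIntegral.continuous_primitive (μ := volume)
        (fun x y => intervalIntegrable_clm_apply (hN x y) ih.continuousOn) a
  let M : ℝ → ℝ := fun x => |∫ s in a..x, ‖N s‖|
  have hMc : Continuous M :=
    (intervalIntegral.continuous_primitive (μ := volume) (fun x y => (hN x y).norm) a).abs
  have hWb (n : ℕ) : ∀ x, ‖W n x‖ ≤ ‖U₀‖ * (M x ^ n / n.factorial) := by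
    induction n with
    | zero => simp [hW0]
    | succ n ih => exact fun x => norm_integral_clm_apply_le (norm_nonneg _) (hN a x) fun t _ => ih t
  have hsum (K : ℝ) : Summable fun n : ℕ => ‖U₀‖ * (K ^ n / n.factorial) :=
    (Real.summable_pow_div_factorial K).mul_left _
  have hWsum (x : ℝ) : Summable fun n => W n x := .of_norm_bounded (hsum (M x)) fun n => hWb n x
  let U : ℝ → E := fun x => ∑' n, W n x
  have hUc : Continuous U := by
    refine continuous_iff_continuousAt.2 fun x => ?_
    obtain ⟨K, hK⟩ := (isCompact_Icc (a := x - 1) (b := x + 1)).exists_bound_of_continuousOn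
      hMc.continuousOn
    refine (continuousOn_tsum (fun n => (hWc n).continuousOn) (hsum K)
      fun n t ht => (hWb n t).trans ?_).continuousAt (Icc_mem_nhds (sub_one_lt x) (lt_add_one x))
    gcongr
    exact (le_abs_self _).trans (hK t ht)
  refine ⟨U, hUc, fun x => ?_⟩
  have hUx : U x = W 0 x + ∑' n, W (n + 1) x := (hWsum x).tsum_eq_zero_add
  rw [hUx, hW0]
  congr 1
  refine HasSum.tsum_eq (f := fun n => W (n + 1) x) ?_
  simp only [hWs]
  -- The dominating series sums to `‖N t‖ * ‖U₀‖ * exp (M t)`, which is integrable because `M` is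
  -- continuous.
  refine intervalIntegral.hasSum_integral_of_dominated_convergence
    (fun n t => ‖N t‖ * (‖U₀‖ * (M t ^ n / n.factorial))) (fun n => ?_) (fun n => ?_) ?_ ?_ ?_
  · exact (intervalIntegrable_iff.1
      (intervalIntegrable_clm_apply (hN a x) (hWc n).continuousOn)).aestronglyMeasurable
  · exact .of_forall fun t _ => (ContinuousLinearMap.le_opNorm _ _).trans
      (mul_le_mul_of_nonneg_left (hWb n t) (norm_nonneg _))
  · exact .of_forall fun t _ => (hsum (M t)).mul_left _
  · have : (fun t => ∑' n : ℕ, ‖N t‖ * (‖U₀‖ * (M t ^ n / n.factorial))) =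
        fun t => ‖N t‖ * (‖U₀‖ * Real.exp (M t)) := by
      funext t
      rw [tsum_mul_left, tsum_mul_left, Real.exp_eq_exp_ℝ, NormedSpace.exp_eq_tsum_div]
    rw [this]
    exact (hN a x).norm.mul_continuousOn (by fun_prop)
  · exact .of_forall fun t _ => (hWsum t).hasSum.mapL (N t)

end LinearSystem

/-! ### Solutions of `y'' = V y` -/

/-- `y` solves `y'' = V y` on `S` in the sense of Carathéodory, with derivative `y'`. -/
structure IsSolutionOn (V : ℝ → ℂ) (S : Set ℝ) (y y' : ℝ → ℂ) : Prop where
  prim : IsPrimitiveOn S y y'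
  prim' : IsPrimitiveOn S y' fun t => V t * y t

namespace IsSolutionOn

variable {V : ℝ → ℂ} {S T : Set ℝ} {y y' z z' : ℝ → ℂ}

theorem mono (h : IsSolutionOn V S y y') (hT : T ⊆ S) : IsSolutionOn V T y y' :=
  ⟨h.prim.mono hT, h.prim'.mono hT⟩

theorem linearCombination (hS : S.OrdConnected) (hy : IsSolutionOn V S y y')
    (hz : IsSolutionOn V S z z') (α β : ℂ) :
    IsSolutionOn V S (fun x => α * y x + β * z x) (fun x => α * y' x + β * z' x) :=
  ⟨(hy.prim.const_mul α).add (hz.prim.const_mul β),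
    ((hy.prim'.const_mul α).add (hz.prim'.const_mul β)).congr hS (fun _ _ => rfl)
      fun x _ => by ring⟩

theorem wronskian_eq (hS : S.OrdConnected) (hy : IsSolutionOn V S y y')
    (hz : IsSolutionOn V S z z') {u v : ℝ} (hu : u ∈ S) (hv : v ∈ S) :
    y u * z' u - y' u * z u = y v * z' v - y' v * z v := by
  have h := ((hy.prim.mul hz.prim' hS).add ((hy.prim'.mul hz.prim hS).const_mul (-1))) u hu v hv
  have h0 : ∫ t in u..v, (y' t * z' t + y t * (V t * z t) +
      -1 * (V t * y t * z t + y' t * z' t)) = 0 := by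
    rw [← intervalIntegral.integral_zero (μ := volume) (a := u) (b := v)]
    congr 1
    funext t
    ring
  have := h.2.trans h0
  linear_combination -this

/-- A bound for the derivative of a solution by the solution on the next unit interval. -/
theorem norm_deriv_le (hS : S.OrdConnected) (hy : IsSolutionOn V S y y') {x B K : ℝ} (hx : x ∈ S)
    (hx1 : x + 1 ∈ S) (hB : ∀ t ∈ Set.Icc x (x + 1), ‖y t‖ ≤ B)
    (hV : IntervalIntegrable V volume x (x + 1)) (hK : ∫ t in x..(x + 1), ‖V t‖ ≤ K) :
    ‖y' x‖ ≤ (2 + K) * B := by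
  have hle : x ≤ x + 1 := by linarith
  have hB0 : 0 ≤ B := (norm_nonneg _).trans (hB x ⟨le_rfl, hle⟩)
  have hd : ∀ t ∈ Set.Icc x (x + 1), ‖y' t - y' x‖ ≤ K * B := by
    intro t ht
    rw [(hy.prim' x hx t (hS.out hx hx1 ht)).2]
    have hVt := hV.mono_set (Set.uIcc_subset_uIcc_left (by rwa [Set.uIcc_of_le hle]))
    calc ‖∫ s in x..t, V s * y s‖ ≤ ∫ s in x..t, ‖V s‖ * B := by
          refine intervalIntegral.norm_integral_le_of_norm_le ht.1 (.of_forall fun s hs => ?_)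
            (hVt.norm.mul_const B)
          rw [norm_mul]
          exact mul_le_mul_of_nonneg_left (hB s ⟨hs.1.le, hs.2.trans ht.2⟩) (norm_nonneg _)
      _ = (∫ s in x..t, ‖V s‖) * B := intervalIntegral.integral_mul_const _ _
      _ ≤ (∫ s in x..(x + 1), ‖V s‖) * B := by
          gcongr
          exact intervalIntegral.integral_mono_interval le_rfl ht.1 ht.2
            (.of_forall fun _ => norm_nonneg _) hV.norm
      _ ≤ K * B := by gcongr
  obtain ⟨hi, he⟩ := hy.prim x hx (x + 1) hx1
  have h2 : ‖∫ t in x..(x + 1), (y' t - y' x)‖ ≤ K * B * |x + 1 - x| :=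
    intervalIntegral.norm_integral_le_of_norm_le_const fun t ht => by
      rw [Set.uIoc_of_le hle] at ht
      exact hd t ⟨ht.1.le, ht.2⟩
  rw [intervalIntegral.integral_sub hi intervalIntegrable_const, ← he,
    intervalIntegral.integral_const, add_sub_cancel_left, one_smul, abs_one, mul_one] at h2
  -- The last bracket is the integral of `y' t - y' x` over the unit interval, at most `K * B` by
  -- `hd`; the first is at most `2 * B`.
  have e : y' x = (y (x + 1) - y x) - (y (x + 1) - y x - y' x) := by ring
  rw [e]
  refine (norm_sub_le _ _).trans ?_
  have h3 := norm_sub_le (y (x + 1)) (y x)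
  have h4 := hB x ⟨le_rfl, hle⟩
  have h5 := hB (x + 1) ⟨hle, le_rfl⟩
  linarith

end IsSolutionOn

/-! ### Everywhere convergent power series -/

/-- The factor k + 1 is at most 2 ^ (k + 1), so doubling the radius absorbs it. The conclusion has
the shape of the hypothesis, which permits repeated termwise differentiation. -/
theorem summable_norm_deriv_coeff {c : ℕ → ℂ}
    (hc : ∀ r : ℝ, 0 ≤ r → Summable fun k => ‖c k‖ * r ^ k) (r : ℝ) (hr : 0 ≤ r) :
    Summable fun k : ℕ => ‖((k : ℂ) + 1) * c (k + 1)‖ * r ^ k := by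
  have h := (summable_nat_add_iff 1).2 (hc (2 * max r 1) (by positivity))
  refine Summable.of_nonneg_of_le (fun k => by positivity) (fun k => ?_) h
  have h1 : ‖((k : ℂ) + 1)‖ ≤ 2 ^ (k + 1) := by
    have : ((k : ℂ) + 1) = ((k + 1 : ℕ) : ℂ) := by push_cast; rfl
    rw [this, Complex.norm_natCast]
    exact_mod_cast (Nat.lt_two_pow_self (n := k + 1)).le
  have h2 : r ^ k ≤ max r 1 ^ (k + 1) :=
    (pow_le_pow_left₀ hr (le_max_left _ _) k).trans
      (pow_le_pow_right₀ (le_max_right _ _) (Nat.le_succ k))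
  calc ‖((k : ℂ) + 1) * c (k + 1)‖ * r ^ k = ‖c (k + 1)‖ * (‖((k : ℂ) + 1)‖ * r ^ k) := by
        rw [norm_mul]; ring
    _ ≤ ‖c (k + 1)‖ * (2 ^ (k + 1) * max r 1 ^ (k + 1)) := by gcongr
    _ = _ := by rw [mul_pow]

theorem summable_coeff_mul_pow {c : ℕ → ℂ}
    (hc : ∀ r : ℝ, 0 ≤ r → Summable fun k => ‖c k‖ * r ^ k) (z : ℂ) :
    Summable fun k => c k * z ^ k :=
  .of_norm (by simpa [norm_mul, norm_pow] using hc ‖z‖ (norm_nonneg z))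

theorem hasDerivAt_tsum_coeff {c : ℕ → ℂ}
    (hc : ∀ r : ℝ, 0 ≤ r → Summable fun k => ‖c k‖ * r ^ k) (z : ℂ) :
    HasDerivAt (fun w => ∑' k, c k * w ^ k) (∑' k : ℕ, ((k : ℂ) + 1) * c (k + 1) * z ^ k) z := by
  have hR : (0 : ℝ) ≤ ‖z‖ + 1 := by positivity
  have hs := summable_norm_deriv_coeff hc (‖z‖ + 1) hR
  have hu : Summable fun k : ℕ => ‖c k‖ * (k * (‖z‖ + 1) ^ (k - 1)) := by
    rw [← summable_nat_add_iff 1]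
    refine hs.congr fun k => ?_
    have : ‖((k : ℂ) + 1)‖ = (k + 1 : ℕ) := by
      rw [← Complex.norm_natCast]; push_cast; rfl
    rw [norm_mul, this, Nat.add_sub_cancel]
    ring
  have h := hasDerivAt_tsum_of_isPreconnected (g := fun k w => c k * w ^ k)
    (g' := fun k w => c k * (k * w ^ (k - 1))) (t := Metric.ball 0 (‖z‖ + 1)) (y₀ := 0) (y := z)
    hu Metric.isOpen_ball (convex_ball _ _).isPreconnected
    (fun k y _ => (hasDerivAt_pow k y).const_mul (c k))
    (fun k y hy => by
      rw [norm_mul, norm_mul, norm_pow, Complex.norm_natCast]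
      have : ‖y‖ ≤ ‖z‖ + 1 := (mem_ball_zero_iff.1 hy).le
      gcongr)
    (by simpa using hR.lt_of_ne (by positivity)) (summable_coeff_mul_pow hc 0) (by simp)
  refine h.congr_deriv ?_
  have hs' : Summable fun k : ℕ => c k * (k * z ^ (k - 1)) := by
    refine .of_norm_bounded hu fun k => ?_
    rw [norm_mul, norm_mul, norm_pow, Complex.norm_natCast]
    gcongr
    linarith
  rw [hs'.tsum_eq_zero_add]
  simp only [Nat.cast_zero, zero_mul, mul_zero, zero_add, Nat.add_sub_cancel]
  refine tsum_congr fun k => ?_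
  push_cast
  ring

namespace BesselSL

variable {P : BesselSL}

/-! ### The solutions of the equation with zero potential -/

/-- Since μ_j is a root of the indicial polynomial μ (μ - 1) - ν₀, the factor s splits off. -/
theorem indicial_eq (P : BesselSL) (j : Fin 2) (s : ℂ) :
    (2 * s + P.μ j) * (2 * s + P.μ j - 1) - P.ν₀ = 4 * s * (s + (-1) ^ ((j : ℕ) + 1) * P.ν) := by
  have h : ((-1 : ℂ) ^ ((j : ℕ) + 1)) ^ 2 = 1 := by rw [← pow_mul, mul_comm, pow_mul]; simp
  simp only [μ, ν₀]
  linear_combination P.ν ^ 2 * h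

/-- The critical factor is s - ν for the first exponent, excluded by the assumption on ν, and s + ν
for the second, which has positive real part. -/
theorem indicial_ne_zero (hν : 0 < P.ν.re) (hν' : ∀ n : ℕ, 1 ≤ n → P.ν ≠ (n : ℂ)) (j : Fin 2)
    {s : ℕ} (hs : 1 ≤ s) : (2 * (s : ℂ) + P.μ j) * (2 * (s : ℂ) + P.μ j - 1) - P.ν₀ ≠ 0 := by
  rw [indicial_eq]
  have hs0 : (s : ℂ) ≠ 0 := by exact_mod_cast (by omega : s ≠ 0)
  refine mul_ne_zero (mul_ne_zero (by norm_num) hs0) ?_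
  fin_cases j
  · simp only [zero_add, pow_one, neg_mul, one_mul]
    intro h
    exact hν' s hs (by linear_combination -h)
  · intro h
    have := congrArg Complex.re h
    simp at this
    have h0 : (0 : ℝ) ≤ s := by positivity
    linarith

theorem coeff_succ (P : BesselSL) (j : Fin 2) (k : ℕ)
    (h : (2 * ((k + 1 : ℕ) : ℂ) + P.μ j) * (2 * ((k + 1 : ℕ) : ℂ) + P.μ j - 1) - P.ν₀ ≠ 0) :
    P.coeff j (k + 1) *
      ((2 * ((k + 1 : ℕ) : ℂ) + P.μ j) * (2 * ((k + 1 : ℕ) : ℂ) + P.μ j - 1) - P.ν₀) =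
      -P.coeff j k := by
  rw [coeff, coeff, Finset.prod_Icc_succ_top (by omega), mul_inv, ← mul_assoc,
    inv_mul_cancel_right₀ h, pow_succ]
  ring

theorem summable_norm_coeff (hν : 0 < P.ν.re) (hν' : ∀ n : ℕ, 1 ≤ n → P.ν ≠ (n : ℂ)) (j : Fin 2)
    (r : ℝ) (hr : 0 ≤ r) : Summable fun k => ‖P.coeff j k‖ * r ^ k := by
  refine summable_of_ratio_norm_eventually_le (r := 1 / 4) (by norm_num) ?_
  -- From this index on |k + 1 ± ν| ≥ r, and the factor 4 in the recurrence gives the ratio 1/4.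
  filter_upwards [eventually_ge_atTop ⌈‖P.ν‖ + r⌉₊] with k hk
  have hk' : ‖P.ν‖ + r ≤ k := Nat.ceil_le.1 hk
  have h := congrArg norm (P.coeff_succ j k (indicial_ne_zero hν hν' j (by omega)))
  rw [indicial_eq, norm_mul, norm_neg, norm_mul, norm_mul, Complex.norm_natCast] at h
  have h1 : r ≤ ‖((k + 1 : ℕ) : ℂ) + (-1) ^ ((j : ℕ) + 1) * P.ν‖ := by
    have := norm_sub_le_norm_add ((k + 1 : ℕ) : ℂ) ((-1) ^ ((j : ℕ) + 1) * P.ν)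
    rw [norm_mul, norm_pow, norm_neg, norm_one, one_pow, one_mul, Complex.norm_natCast] at this
    push_cast at this ⊢
    linarith
  rw [norm_mul, norm_mul, norm_norm, norm_norm, norm_pow, norm_pow, Real.norm_of_nonneg hr, ← h,
    pow_succ]
  have h4 : ‖(4 : ℂ)‖ = 4 := by norm_num
  rw [h4]
  have hk1 : (1 : ℝ) ≤ ((k + 1 : ℕ) : ℝ) := by exact_mod_cast Nat.le_add_left 1 k
  have h2 : r ≤ ((k + 1 : ℕ) : ℝ) * ‖((k + 1 : ℕ) : ℂ) + (-1) ^ ((j : ℕ) + 1) * P.ν‖ :=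
    h1.trans (le_mul_of_one_le_left (norm_nonneg _) hk1)
  have h3 : 0 ≤ ‖P.coeff j (k + 1)‖ * r ^ k := by positivity
  nlinarith [mul_le_mul_of_nonneg_left h2 h3]

/-- The power series `∑ₖ c_{jk} zᵏ`. -/
def series (P : BesselSL) (j : Fin 2) (z : ℂ) : ℂ := ∑' k, P.coeff j k * z ^ k

/-- The derivative of `series`. -/
def series' (P : BesselSL) (j : Fin 2) (z : ℂ) : ℂ :=
  ∑' k : ℕ, ((k : ℂ) + 1) * P.coeff j (k + 1) * z ^ k

/-- The second derivative of `series`. -/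
def series'' (P : BesselSL) (j : Fin 2) (z : ℂ) : ℂ :=
  ∑' k : ℕ, ((k : ℂ) + 1) * (((k + 1 : ℕ) : ℂ) + 1) * P.coeff j (k + 1 + 1) * z ^ k

theorem hasDerivAt_series (hν : 0 < P.ν.re) (hν' : ∀ n : ℕ, 1 ≤ n → P.ν ≠ (n : ℂ)) (j : Fin 2)
    (z : ℂ) : HasDerivAt (P.series j) (P.series' j z) z :=
  hasDerivAt_tsum_coeff (summable_norm_coeff hν hν' j) z

theorem hasDerivAt_series' (hν : 0 < P.ν.re) (hν' : ∀ n : ℕ, 1 ≤ n → P.ν ≠ (n : ℂ)) (j : Fin 2)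
    (z : ℂ) : HasDerivAt (P.series' j) (P.series'' j z) z := by
  have := hasDerivAt_tsum_coeff (summable_norm_deriv_coeff (summable_norm_coeff hν hν' j)) z
  refine this.congr_deriv (tsum_congr fun k => ?_)
  ring

/-- The differential equation satisfied by `series`. -/
theorem series_ode (hν : 0 < P.ν.re) (hν' : ∀ n : ℕ, 1 ≤ n → P.ν ≠ (n : ℂ)) (j : Fin 2) (z : ℂ) :
    4 * z * P.series'' j z + (4 * P.μ j + 2) * P.series' j z + P.series j z = 0 := by
  have s0 := summable_norm_coeff hν hν' j
  have s1 := summable_norm_deriv_coeff s0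
  have s2 := summable_norm_deriv_coeff s1
  have h0 := summable_coeff_mul_pow s0 z
  have h1 := summable_coeff_mul_pow s1 z
  have h2 := summable_coeff_mul_pow s2 z
  -- Multiplication by z shifts the index; the factor k makes the new zeroth term vanish, so all
  -- three series can be compared coefficientwise and `coeff_succ` applies.
  have h2' : Summable fun k : ℕ => ((k : ℂ) * (k + 1) * P.coeff j (k + 1)) * z ^ k := by
    rw [← summable_nat_add_iff 1]
    refine (h2.mul_left z).congr fun k => ?_
    push_cast
    ring
  have e2 : z * P.series'' j z = ∑' k : ℕ, ((k : ℂ) * (k + 1) * P.coeff j (k + 1)) * z ^ k := by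
    rw [h2'.tsum_eq_zero_add, series'', ← tsum_mul_left]
    simp only [Nat.cast_zero, zero_mul, zero_add]
    refine tsum_congr fun k => ?_
    push_cast
    ring
  have e : 4 * z * P.series'' j z + (4 * P.μ j + 2) * P.series' j z + P.series j z =
      4 * (z * P.series'' j z) + (4 * P.μ j + 2) * P.series' j z + P.series j z := by ring
  rw [e, e2, series', series, ← tsum_mul_left, ← tsum_mul_left,
    ← (h2'.mul_left 4).tsum_add (h1.mul_left _),
    ← ((h2'.mul_left 4).add (h1.mul_left _)).tsum_add h0]
  refine (tsum_congr fun k => ?_).trans tsum_zero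
  have h := P.coeff_succ j k (indicial_ne_zero hν hν' j (by omega))
  rw [indicial_eq] at h
  simp only [μ]
  push_cast at h ⊢
  linear_combination z ^ k * h

theorem μ_add (P : BesselSL) : P.μ 0 + P.μ 1 = 1 := by simp [μ]; ring

/-- This is the Wronskian of C₁, C₂ freed of the powers, which cancel because μ₁ + μ₂ = 1. By
`series_ode` its derivative in z vanishes, and at z = 0 it is c₁₀ c₂₀ (μ₂ - μ₁) = 1. Working in z
gives the same value on both sides of `a`, with no branch of the power involved. -/
theorem series_wronskian (hν : 0 < P.ν.re) (hν' : ∀ n : ℕ, 1 ≤ n → P.ν ≠ (n : ℂ))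
    (hc : P.c 0 * P.c 1 = (2 * P.ν)⁻¹) (z : ℂ) :
    P.series 0 z * (P.μ 1 * P.series 1 z + 2 * z * P.series' 1 z) -
      (P.μ 0 * P.series 0 z + 2 * z * P.series' 0 z) * P.series 1 z = 1 := by
  have d (w : ℂ) : HasDerivAt (fun z =>
      P.series 0 z * (P.μ 1 * P.series 1 z + 2 * z * P.series' 1 z) -
      (P.μ 0 * P.series 0 z + 2 * z * P.series' 0 z) * P.series 1 z) 0 w := by
    have a0 := hasDerivAt_series hν hν' 0 w
    have a1 := hasDerivAt_series hν hν' 1 w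
    have b0 := hasDerivAt_series' hν hν' 0 w
    have b1 := hasDerivAt_series' hν hν' 1 w
    have l : HasDerivAt (fun z : ℂ => 2 * z) 2 w := by simpa using (hasDerivAt_id w).const_mul 2
    refine ((a0.mul ((a1.const_mul (P.μ 1)).add (l.mul b1))).sub
      (((a0.const_mul (P.μ 0)).add (l.mul b0)).mul a1)).congr_deriv ?_
    have o0 := series_ode hν hν' 0 w
    have o1 := series_ode hν hν' 1 w
    have hμ := P.μ_add
    simp only [Pi.add_apply, Pi.mul_apply]
    linear_combination (1 / 2 * P.series 0 w) * o1 - (1 / 2 * P.series 1 w) * o0 -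
      (P.series 0 w * P.series' 1 w - P.series' 0 w * P.series 1 w) * hμ
  have h := is_const_of_deriv_eq_zero (fun w => (d w).differentiableAt) (fun w => (d w).deriv) z 0
  refine h.trans ?_
  have s0 (j : Fin 2) : P.series j 0 = P.c j := by
    rw [series, tsum_eq_single 0 (by intro k hk; simp [hk])]
    simp [coeff]
  rw [s0, s0]
  have hν0 : P.ν ≠ 0 := fun h => by simp [h] at hν
  have hμ : P.μ 1 - P.μ 0 = 2 * P.ν := by simp [μ]; ring
  have : P.c 0 * P.c 1 * (2 * P.ν) = 1 := by rw [hc]; field_simp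
  linear_combination P.c 0 * P.c 1 * hμ + this

end BesselSL

/-- Left of `a` the base lies on the branch cut, but along the real line its argument is constant
and the usual rule holds. The result has the same form with m - 1 and a new entire function, so a
second application yields the second derivative. -/
theorem hasDerivAt_cpow_mul_comp_sq {F F' : ℂ → ℂ} (hF : ∀ z, HasDerivAt F (F' z) z) (m lam : ℂ)
    {a x : ℝ} (hx : x ≠ a) :
    HasDerivAt (fun x : ℝ => ((x - a : ℝ) : ℂ) ^ m * F (lam * ((x - a : ℝ) : ℂ) ^ 2))
      (((x - a : ℝ) : ℂ) ^ (m - 1) * (m * F (lam * ((x - a : ℝ) : ℂ) ^ 2) +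
        2 * (lam * ((x - a : ℝ) : ℂ) ^ 2) * F' (lam * ((x - a : ℝ) : ℂ) ^ 2))) x := by
  have hxa : x - a ≠ 0 := sub_ne_zero.2 hx
  have hxa' : ((x - a : ℝ) : ℂ) ≠ 0 := by exact_mod_cast hxa
  have l : HasDerivAt (fun x : ℝ => ((x - a : ℝ) : ℂ)) 1 x :=
    ((hasDerivAt_id x).sub_const a).ofReal_comp
  have hp : HasDerivAt (fun x : ℝ => ((x - a : ℝ) : ℂ) ^ m) (m * ((x - a : ℝ) : ℂ) ^ (m - 1)) x := by
    rcases eq_or_ne m 0 with rfl | hm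
    · simpa using hasDerivAt_const x (1 : ℂ)
    · simpa [Function.comp_def] using
        (hasDerivAt_ofReal_cpow_const hxa hm).scomp x ((hasDerivAt_id x).sub_const a)
  have hs : HasDerivAt (fun x : ℝ => lam * ((x - a : ℝ) : ℂ) ^ 2)
      (lam * (2 * ((x - a : ℝ) : ℂ))) x := by
    simpa using (l.pow 2).const_mul lam
  have hFc := (hF (lam * ((x - a : ℝ) : ℂ) ^ 2)).comp x hs
  refine (hp.mul hFc).congr_deriv ?_
  rw [Complex.cpow_sub _ _ hxa', Complex.cpow_one, Function.comp_apply]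
  field_simp

namespace BesselSL

variable {P : BesselSL}

theorem C_eq (P : BesselSL) (j : Fin 2) (lam : ℂ) (x : ℝ) : P.C j x lam =
    ((x - P.a : ℝ) : ℂ) ^ P.μ j * P.series j (lam * ((x - P.a : ℝ) : ℂ) ^ 2) := rfl

/-- The derivative of `C_j(x, λ)` in `x`. -/
def C' (P : BesselSL) (j : Fin 2) (x : ℝ) (lam : ℂ) : ℂ :=
  ((x - P.a : ℝ) : ℂ) ^ (P.μ j - 1) * (P.μ j * P.series j (lam * ((x - P.a : ℝ) : ℂ) ^ 2) +
    2 * (lam * ((x - P.a : ℝ) : ℂ) ^ 2) * P.series' j (lam * ((x - P.a : ℝ) : ℂ) ^ 2))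

theorem hasDerivAt_C (hν : 0 < P.ν.re) (hν' : ∀ n : ℕ, 1 ≤ n → P.ν ≠ (n : ℂ)) (j : Fin 2)
    (lam : ℂ) {x : ℝ} (hx : x ≠ P.a) :
    HasDerivAt (fun x => P.C j x lam) (P.C' j x lam) x :=
  hasDerivAt_cpow_mul_comp_sq (hasDerivAt_series hν hν' j) (P.μ j) lam hx

theorem hasDerivAt_C' (hν : 0 < P.ν.re) (hν' : ∀ n : ℕ, 1 ≤ n → P.ν ≠ (n : ℂ)) (j : Fin 2)
    (lam : ℂ) {x : ℝ} (hx : x ≠ P.a) :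
    HasDerivAt (fun x => P.C' j x lam)
      ((P.ν₀ / ((x - P.a : ℝ) : ℂ) ^ 2 - lam) * P.C j x lam) x := by
  have hF (z : ℂ) : HasDerivAt (fun z => P.μ j * P.series j z + 2 * z * P.series' j z)
      (P.μ j * P.series' j z + (2 * P.series' j z + 2 * z * P.series'' j z)) z := by
    have l : HasDerivAt (fun z : ℂ => 2 * z) 2 z := by simpa using (hasDerivAt_id z).const_mul 2
    exact ((hasDerivAt_series hν hν' j z).const_mul _).add (l.mul (hasDerivAt_series' hν hν' j z))
  have h := hasDerivAt_cpow_mul_comp_sq hF (P.μ j - 1) lam hx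
  have hxa : ((x - P.a : ℝ) : ℂ) ≠ 0 := by exact_mod_cast sub_ne_zero.2 hx
  refine HasDerivAt.congr_deriv h ?_
  rw [C_eq]
  have e : P.μ j - 1 - 1 = P.μ j - 2 := by ring
  rw [e, Complex.cpow_sub _ _ hxa, Complex.cpow_ofNat]
  have o := series_ode hν hν' j (lam * ((x - P.a : ℝ) : ℂ) ^ 2)
  have hμ : P.μ j * (P.μ j - 1) - P.ν₀ = 0 := by simpa using P.indicial_eq j 0
  generalize P.series j (lam * ((x - P.a : ℝ) : ℂ) ^ 2) = F at o ⊢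
  generalize P.series' j (lam * ((x - P.a : ℝ) : ℂ) ^ 2) = F' at o ⊢
  generalize P.series'' j (lam * ((x - P.a : ℝ) : ℂ) ^ 2) = F'' at o ⊢
  generalize ((x - P.a : ℝ) : ℂ) ^ P.μ j = H
  field_simp
  linear_combination (H * (lam * ((x - P.a : ℝ) : ℂ) ^ 2)) * o + H * F * hμ

theorem C_wronskian (hν : 0 < P.ν.re) (hν' : ∀ n : ℕ, 1 ≤ n → P.ν ≠ (n : ℂ))
    (hc : P.c 0 * P.c 1 = (2 * P.ν)⁻¹) (lam : ℂ) {x : ℝ} (hx : x ≠ P.a) :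
    P.C 0 x lam * P.C' 1 x lam - P.C' 0 x lam * P.C 1 x lam = 1 := by
  have hxa : ((x - P.a : ℝ) : ℂ) ≠ 0 := by exact_mod_cast sub_ne_zero.2 hx
  have h1 : ((x - P.a : ℝ) : ℂ) ^ P.μ 0 * ((x - P.a : ℝ) : ℂ) ^ (P.μ 1 - 1) = 1 := by
    rw [← Complex.cpow_add _ _ hxa, ← add_sub_assoc, μ_add, sub_self, Complex.cpow_zero]
  have h2 : ((x - P.a : ℝ) : ℂ) ^ (P.μ 0 - 1) * ((x - P.a : ℝ) : ℂ) ^ P.μ 1 = 1 := by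
    rw [← Complex.cpow_add _ _ hxa, sub_add_eq_add_sub, μ_add, sub_self, Complex.cpow_zero]
  have w := series_wronskian hν hν' hc (lam * ((x - P.a : ℝ) : ℂ) ^ 2)
  rw [C_eq, C_eq, C', C']
  linear_combination w + (P.series 0 (lam * ((x - P.a : ℝ) : ℂ) ^ 2) *
    (P.μ 1 * P.series 1 (lam * ((x - P.a : ℝ) : ℂ) ^ 2) + 2 * (lam * ((x - P.a : ℝ) : ℂ) ^ 2) *
    P.series' 1 (lam * ((x - P.a : ℝ) : ℂ) ^ 2))) * h1 -
    ((P.μ 0 * P.series 0 (lam * ((x - P.a : ℝ) : ℂ) ^ 2) + 2 * (lam * ((x - P.a : ℝ) : ℂ) ^ 2) *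
    P.series' 0 (lam * ((x - P.a : ℝ) : ℂ) ^ 2)) *
    P.series 1 (lam * ((x - P.a : ℝ) : ℂ) ^ 2)) * h2

theorem continuousOn_C (hν : 0 < P.ν.re) (hν' : ∀ n : ℕ, 1 ≤ n → P.ν ≠ (n : ℂ)) (j : Fin 2)
    (lam : ℂ) : ContinuousOn (fun x => P.C j x lam) {P.a}ᶜ :=
  fun _ hx => (hasDerivAt_C hν hν' j lam hx).continuousAt.continuousWithinAt

theorem continuousOn_C' (hν : 0 < P.ν.re) (hν' : ∀ n : ℕ, 1 ≤ n → P.ν ≠ (n : ℂ)) (j : Fin 2)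
    (lam : ℂ) : ContinuousOn (fun x => P.C' j x lam) {P.a}ᶜ :=
  fun _ hx => (hasDerivAt_C' hν hν' j lam hx).continuousAt.continuousWithinAt

theorem continuousOn_const_div_sub_sq (P : BesselSL) (lam : ℂ) :
    ContinuousOn (fun x : ℝ => P.ν₀ / ((x - P.a : ℝ) : ℂ) ^ 2 - lam) {P.a}ᶜ := by
  refine (continuousOn_const.div (by fun_prop) fun x hx => ?_).sub continuousOn_const
  exact pow_ne_zero 2 (by exact_mod_cast sub_ne_zero.2 hx)

theorem aestronglyMeasurable_of_continuousOn_compl_singleton {f : ℝ → ℂ} {a : ℝ}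
    (hf : ContinuousOn f {a}ᶜ) : AEStronglyMeasurable f volume := by
  have h := hf.aestronglyMeasurable (μ := volume) (measurableSet_singleton a).compl
  rwa [Measure.restrict_eq_self_of_ae_mem (by simp [ae_iff, measure_singleton])] at h

/-- The exponent is half that of the potential class, so that a product of two C's meets exactly the
weight of q. Both Re μ_j are at least this exponent, and the surplus power is bounded by a power of
R; the exponential absorbs the argument π that occurs left of `a`. -/
theorem exists_norm_C_le (hν : 0 < P.ν.re) (hν' : ∀ n : ℕ, 1 ≤ n → P.ν ≠ (n : ℂ)) (j : Fin 2)
    (lam : ℂ) {R : ℝ} (hR : 0 ≤ R) : ∃ K : ℝ, 0 ≤ K ∧ ∀ x, x ≠ P.a → |x - P.a| ≤ R →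
      ‖P.C j x lam‖ ≤ K * |x - P.a| ^ (min 0 (1 - 2 * P.ν.re) / 2) := by
  have hcont : Continuous fun x : ℝ => P.series j (lam * ((x - P.a : ℝ) : ℂ) ^ 2) := by
    have : Continuous (P.series j) :=
      continuous_iff_continuousAt.2 fun z => (hasDerivAt_series hν hν' j z).continuousAt
    fun_prop
  obtain ⟨K, hK⟩ := (isCompact_Icc (a := P.a - R) (b := P.a + R)).exists_bound_of_continuousOn
    hcont.continuousOn
  set p := min 0 (1 - 2 * P.ν.re) / 2 with hp
  have hpμ : 0 ≤ (P.μ j).re - p := by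
    have h1 : p ≤ 0 := by rw [hp]; linarith [min_le_left 0 (1 - 2 * P.ν.re)]
    have h2 : p ≤ 1 / 2 - P.ν.re := by rw [hp]; linarith [min_le_right 0 (1 - 2 * P.ν.re)]
    fin_cases j
    · simp [μ]; linarith
    · simp [μ]; linarith
  refine ⟨Real.exp (Real.pi * |(P.μ j).im|) * R ^ ((P.μ j).re - p) * |K|, by positivity, fun x hx hxR => ?_⟩
  have hpos : 0 < |x - P.a| := abs_pos.2 (sub_ne_zero.2 hx)
  have hxa : ((x - P.a : ℝ) : ℂ) ≠ 0 := by exact_mod_cast sub_ne_zero.2 hx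
  rw [C_eq, norm_mul, Complex.norm_cpow_of_ne_zero hxa, Complex.norm_real, Real.norm_eq_abs]
  have h1 : ‖P.series j (lam * ((x - P.a : ℝ) : ℂ) ^ 2)‖ ≤ |K| :=
    (hK x (by rw [abs_le] at hxR; constructor <;> linarith)).trans (le_abs_self K)
  have h2 : |x - P.a| ^ (P.μ j).re ≤ R ^ ((P.μ j).re - p) * |x - P.a| ^ p := by
    have e : (P.μ j).re = ((P.μ j).re - p) + p := by ring
    rw [e, Real.rpow_add hpos, ← e]
    gcongr
  have h3 : 1 / Real.exp (Complex.arg ((x - P.a : ℝ) : ℂ) * (P.μ j).im) ≤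
      Real.exp (Real.pi * |(P.μ j).im|) := by
    rw [one_div, ← Real.exp_neg]
    refine Real.exp_le_exp.2 ((neg_le_abs _).trans ?_)
    rw [abs_mul]
    gcongr
    exact Complex.abs_arg_le_pi _
  calc _ = |x - P.a| ^ (P.μ j).re * (1 / Real.exp (Complex.arg ((x - P.a : ℝ) : ℂ) * (P.μ j).im)) *
        ‖P.series j (lam * ((x - P.a : ℝ) : ℂ) ^ 2)‖ := by ring
    _ ≤ (R ^ ((P.μ j).re - p) * |x - P.a| ^ p) * Real.exp (Real.pi * |(P.μ j).im|) * |K| := by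
        gcongr
    _ = _ := by ring

end BesselSL

namespace BesselSL

variable {P : BesselSL}

/-! ### Integrability of the potential -/

/-- Up to T the weight is the one in the hypothesis on q; beyond T it is bounded, as the exponent is
nonpositive and x stays away from `a`. -/
theorem PotentialClass.integrableOn_mul (hq : P.PotentialClass) {w : ℝ → ℂ}
    (hwm : AEStronglyMeasurable w volume)
    (hw : ∀ R : ℝ, 0 ≤ R → ∃ K : ℝ, 0 ≤ K ∧ ∀ x, x ≠ P.a → |x - P.a| ≤ R →
      ‖w x‖ ≤ K * |x - P.a| ^ min 0 (1 - 2 * P.ν.re)) (X : ℝ) :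
    IntegrableOn (fun x => P.q x * w x) (Set.Icc 0 X) := by
  obtain ⟨T, hT, h1, h2⟩ := hq
  set m := min 0 (1 - 2 * P.ν.re) with hm
  have hm0 : m ≤ 0 := min_le_left _ _
  have hne : ∀ᵐ x : ℝ, x ≠ P.a := by simp [ae_iff, measure_singleton]
  have i1 : IntegrableOn (fun x => P.q x * w x) (Set.Icc 0 T) := by
    rw [integrableOn_Icc_iff_integrableOn_Ioo]
    obtain ⟨K, hK0, hK⟩ := hw (|P.a| + |T|) (by positivity)
    -- Measurability is known only for the weighted q, so the inverse weight is attached to `w`.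
    have hrm : AEStronglyMeasurable (fun x : ℝ => ((|x - P.a| ^ (-m) : ℝ) : ℂ) * w x)
        (volume.restrict (Set.Ioo 0 T)) := by
      refine AEStronglyMeasurable.mul ?_ hwm.restrict
      exact (by fun_prop : Measurable fun x : ℝ => ((|x - P.a| ^ (-m) : ℝ) : ℂ)).aestronglyMeasurable
    refine (h1.norm.const_mul K).mono' ((h1.aestronglyMeasurable.mul hrm).congr ?_) ?_
    · filter_upwards [ae_restrict_of_ae hne] with x hx
      have hpos : 0 < |x - P.a| := abs_pos.2 (sub_ne_zero.2 hx)
      have e : ((|x - P.a| ^ m : ℝ) : ℂ) * ((|x - P.a| ^ (-m) : ℝ) : ℂ) = 1 := by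
        rw [← Complex.ofReal_mul, ← Real.rpow_add hpos, add_neg_cancel, Real.rpow_zero,
          Complex.ofReal_one]
      simp only [Pi.mul_apply]
      linear_combination P.q x * w x * e
    · filter_upwards [ae_restrict_of_ae hne, ae_restrict_mem measurableSet_Ioo] with x hx hx'
      rw [norm_mul, norm_mul, Complex.norm_real, Real.norm_of_nonneg (by positivity)]
      have := hK x hx (by
        refine (abs_sub _ _).trans ?_
        rw [add_comm, abs_of_pos hx'.1, abs_of_pos (hx'.1.trans hx'.2)]
        linarith [hx'.2])
      calc ‖P.q x‖ * ‖w x‖ ≤ ‖P.q x‖ * (K * |x - P.a| ^ m) := by gcongr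
        _ = _ := by ring
  have i2 : IntegrableOn (fun x => P.q x * w x) (Set.Ioc T X) := by
    obtain ⟨K, hK0, hK⟩ := hw (|P.a| + |X|) (by positivity)
    have h2' : IntegrableOn P.q (Set.Ioc T X) := h2.mono_set Set.Ioc_subset_Ioi_self
    refine (h2'.norm.mul_const (K * (T - P.a) ^ m)).mono'
      (h2'.aestronglyMeasurable.mul hwm.restrict) ?_
    filter_upwards [ae_restrict_mem measurableSet_Ioc] with x hx
    have hxa : 0 < x - P.a := by linarith [hx.1]
    have := hK x (by linarith) (by
      rw [abs_of_pos hxa]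
      linarith [hx.2, neg_abs_le P.a, le_abs_self X])
    rw [abs_of_pos hxa] at this
    have h3 : (x - P.a) ^ m ≤ (T - P.a) ^ m :=
      Real.rpow_le_rpow_of_nonpos (by linarith) (by linarith [hx.1]) hm0
    rw [norm_mul]
    gcongr
    exact this.trans (by gcongr)
  refine (i1.union i2).mono_set fun x hx => ?_
  rcases le_or_gt x T with h | h
  · exact .inl ⟨hx.1, h⟩
  · exact .inr ⟨h, hx.2⟩

theorem PotentialClass.integrableOn_C_mul_C (hq : P.PotentialClass) (hν : 0 < P.ν.re)
    (hν' : ∀ n : ℕ, 1 ≤ n → P.ν ≠ (n : ℂ)) (i j : Fin 2) (lam : ℂ) (X : ℝ) :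
    IntegrableOn (fun x => P.q x * (P.C i x lam * P.C j x lam)) (Set.Icc 0 X) := by
  refine hq.integrableOn_mul
    (aestronglyMeasurable_of_continuousOn_compl_singleton
      ((continuousOn_C hν hν' i lam).mul (continuousOn_C hν hν' j lam))) (fun R hR => ?_) X
  obtain ⟨K, hK0, hK⟩ := exists_norm_C_le hν hν' i lam hR
  obtain ⟨L, hL0, hL⟩ := exists_norm_C_le hν hν' j lam hR
  refine ⟨K * L, by positivity, fun x hx hxR => ?_⟩
  have hpos : 0 < |x - P.a| := abs_pos.2 (sub_ne_zero.2 hx)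
  rw [Pi.mul_apply, norm_mul]
  refine (mul_le_mul (hK x hx hxR) (hL x hx hxR) (norm_nonneg _) (by positivity)).trans_eq ?_
  rw [mul_mul_mul_comm, ← Real.rpow_add hpos, add_halves]

/-! ### The integral equation as a linear system -/

/-- The coefficient matrix of the linear system for the coefficients `(u, v)` in
`s_j = u C_1 + v C_2`. -/
def system (P : BesselSL) (lam : ℂ) (t : ℝ) : ℂ × ℂ →L[ℂ] ℂ × ℂ :=
  -- The potential class controls q only on the half-line; cutting off at 0 makes the system
  -- integrable on every bounded interval.
  (Set.Ici 0).indicator (fun t => P.q t * (P.C 1 t lam * P.C 0 t lam)) t •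
      (-((ContinuousLinearMap.inl ℂ ℂ ℂ).comp (ContinuousLinearMap.fst ℂ ℂ ℂ))) +
    (Set.Ici 0).indicator (fun t => P.q t * (P.C 1 t lam * P.C 1 t lam)) t •
      (-((ContinuousLinearMap.inl ℂ ℂ ℂ).comp (ContinuousLinearMap.snd ℂ ℂ ℂ))) +
    (Set.Ici 0).indicator (fun t => P.q t * (P.C 0 t lam * P.C 0 t lam)) t •
      ((ContinuousLinearMap.inr ℂ ℂ ℂ).comp (ContinuousLinearMap.fst ℂ ℂ ℂ)) +
    (Set.Ici 0).indicator (fun t => P.q t * (P.C 0 t lam * P.C 1 t lam)) t •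
      ((ContinuousLinearMap.inr ℂ ℂ ℂ).comp (ContinuousLinearMap.snd ℂ ℂ ℂ))

theorem system_apply (P : BesselSL) (lam : ℂ) {t : ℝ} (ht : 0 ≤ t) (U : ℂ × ℂ) :
    P.system lam t U =
      (-(P.C 1 t lam * P.q t * (U.1 * P.C 0 t lam + U.2 * P.C 1 t lam)),
        P.C 0 t lam * P.q t * (U.1 * P.C 0 t lam + U.2 * P.C 1 t lam)) := by
  have ht' : t ∈ Set.Ici (0 : ℝ) := ht
  simp only [system, Set.indicator_of_mem ht']
  ext
  · simp
    ring
  · simp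
    ring

theorem integrable_smul_const_add_add_add {α E : Type*} [MeasurableSpace α] {m : Measure α}
    [NormedAddCommGroup E] [NormedSpace ℂ E] {f₁ f₂ f₃ f₄ : α → ℂ} (h₁ : Integrable f₁ m)
    (h₂ : Integrable f₂ m) (h₃ : Integrable f₃ m) (h₄ : Integrable f₄ m) (L₁ L₂ L₃ L₄ : E) :
    Integrable (fun t => f₁ t • L₁ + f₂ t • L₂ + f₃ t • L₃ + f₄ t • L₄) m :=
  (((h₁.smul_const L₁).add (h₂.smul_const L₂)).add (h₃.smul_const L₃)).add (h₄.smul_const L₄)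

theorem PotentialClass.intervalIntegrable_system (hq : P.PotentialClass) (hν : 0 < P.ν.re)
    (hν' : ∀ n : ℕ, 1 ≤ n → P.ν ≠ (n : ℂ)) (lam : ℂ) (x y : ℝ) :
    IntervalIntegrable (P.system lam) volume x y := by
  have key (i j : Fin 2) : IntegrableOn
      ((Set.Ici 0).indicator (fun t => P.q t * (P.C i t lam * P.C j t lam))) (Set.uIoc x y) := by
    rw [IntegrableOn, integrable_indicator_iff measurableSet_Ici, IntegrableOn,
      Measure.restrict_restrict measurableSet_Ici]
    exact (hq.integrableOn_C_mul_C hν hν' i j lam (max x y)).mono_set fun t ht =>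
      ⟨ht.1, ht.2.2⟩
  rw [intervalIntegrable_iff]
  exact integrable_smul_const_add_add_add (key 1 0) (key 1 1) (key 0 0) (key 0 1) _ _ _ _

theorem uIcc_a_subset (ha : 0 < P.a) {x : ℝ} (hx : x ∈ P.domain) :
    Set.uIcc P.a x ⊆ Set.Ici 0 := fun _ ht => (le_min ha.le hx.1).trans ht.1

theorem mem_domain_of_mem_uIcc (ha : 0 < P.a) {x t : ℝ} (hx : x ∈ P.domain)
    (ht : t ∈ Set.uIcc P.a x) (hta : t ≠ P.a) : t ∈ P.domain :=
  ⟨uIcc_a_subset ha hx ht, hta⟩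

/-- On an open set avoiding `a` the kernel `g` does not vanish identically. -/
theorem exists_g_ne_zero (hν : 0 < P.ν.re) (hν' : ∀ n : ℕ, 1 ≤ n → P.ν ≠ (n : ℂ))
    (hc : P.c 0 * P.c 1 = (2 * P.ν)⁻¹) (lam : ℂ) {J : Set ℝ} (hJ : IsOpen J) (hne : J.Nonempty)
    (ha : P.a ∉ J) : ∃ y ∈ J, ∃ z ∈ J, P.g y z lam ≠ 0 := by
  by_contra! h
  obtain ⟨z, hz⟩ := hne
  have hza : z ≠ P.a := fun e => ha (e ▸ hz)
  have d : HasDerivAt (fun y => P.g y z lam)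
      (P.C 0 z lam * P.C' 1 z lam - P.C' 0 z lam * P.C 1 z lam) z :=
    ((hasDerivAt_C hν hν' 1 lam hza).const_mul _).sub
      ((hasDerivAt_C hν hν' 0 lam hza).mul_const _)
  have d0 : HasDerivAt (fun y => P.g y z lam) 0 z :=
    (hasDerivAt_const z (0 : ℂ)).congr_of_eventuallyEq
      (by filter_upwards [hJ.mem_nhds hz] with y hy using h y hy z hz)
  have := d.unique d0
  rw [C_wronskian hν hν' hc lam hza] at this
  exact one_ne_zero this

/-- An integral solution is not assumed continuous, only the products with g(x, ·) are integrable.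
Two kernels g(y, ·), g(z, ·) with g(y, z) ≠ 0 are independent combinations of C₁, C₂ and can be
solved for them. The points y, z must lie farther from `a` than x, which is why x = 0 is excluded.
-/
theorem intervalIntegrable_C_mul_of_g (hν : 0 < P.ν.re)
    (hν' : ∀ n : ℕ, 1 ≤ n → P.ν ≠ (n : ℂ)) (hc : P.c 0 * P.c 1 = (2 * P.ν)⁻¹) {lam : ℂ}
    {h : ℝ → ℂ} (hh : ∀ x ∈ P.domain,
      IntervalIntegrable (fun t => P.g x t lam * P.q t * h t) volume P.a x)
    {x : ℝ} (hx : x ∈ P.domain) (hx0 : 0 < x) (i : Fin 2) :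
    IntervalIntegrable (fun t => P.C i t lam * P.q t * h t) volume P.a x := by
  obtain ⟨J, hJ, hne, haJ, hJd⟩ : ∃ J : Set ℝ, IsOpen J ∧ J.Nonempty ∧ P.a ∉ J ∧
      ∀ y ∈ J, y ∈ P.domain ∧ Set.uIcc P.a x ⊆ Set.uIcc P.a y := by
    rcases lt_or_gt_of_ne hx.2 with hxa | hxa
    · refine ⟨Set.Ioo 0 x, isOpen_Ioo, Set.nonempty_Ioo.2 hx0, fun h => by linarith [h.2],
        fun y hy => ⟨⟨hy.1.le, (hy.2.trans hxa).ne⟩, ?_⟩⟩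
      rw [Set.uIcc_of_ge hxa.le, Set.uIcc_of_ge (hy.2.trans hxa).le]
      exact Set.Icc_subset_Icc_left hy.2.le
    · refine ⟨Set.Ioi x, isOpen_Ioi, Set.nonempty_Ioi, fun h => lt_asymm hxa h,
        fun y hy => ⟨⟨hx0.le.trans (le_of_lt hy), (hxa.trans hy).ne'⟩, ?_⟩⟩
      rw [Set.uIcc_of_le hxa.le, Set.uIcc_of_le (hxa.trans hy).le]
      exact Set.Icc_subset_Icc_right (le_of_lt hy)
  obtain ⟨y, hy, z, hz, hyz⟩ := exists_g_ne_zero hν hν' hc lam hJ hne haJ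
  have hy' := (hh y (hJd y hy).1).mono_set (hJd y hy).2
  have hz' := (hh z (hJd z hz).1).mono_set (hJd z hz).2
  -- The identity used is C_i(z) g(y, t) - C_i(y) g(z, t) = g(y, z) C_i(t).
  refine (((hy'.const_mul (P.C i z lam)).sub (hz'.const_mul (P.C i y lam))).const_mul
    (P.g y z lam)⁻¹).congr fun t _ => ?_
  rw [inv_mul_eq_iff_eq_mul₀ hyz]
  fin_cases i
  · simp only [g, Fin.zero_eta]; ring
  · simp only [g, Fin.mk_one]; ring

/-- Although h has no assumed regularity, the integrals of C₂ q h (with a minus sign) and C₁ q h are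
continuous, serve as the coefficients of h in C₁, C₂, and solve the homogeneous system from zero
initial data; hence they vanish. -/
theorem eq_zero_of_homogeneous (ha : 0 < P.a) (hν : 0 < P.ν.re)
    (hν' : ∀ n : ℕ, 1 ≤ n → P.ν ≠ (n : ℂ)) (hc : P.c 0 * P.c 1 = (2 * P.ν)⁻¹)
    (hq : P.PotentialClass) {lam : ℂ} {h : ℝ → ℂ} (hh : ∀ x ∈ P.domain,
      IntervalIntegrable (fun t => P.g x t lam * P.q t * h t) volume P.a x ∧
      h x = ∫ t in P.a..x, P.g x t lam * P.q t * h t) :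
    ∀ x ∈ P.domain, h x = 0 := by
  have hne : ∀ᵐ t : ℝ, t ≠ P.a := by simp [ae_iff, measure_singleton]
  have hpos : ∀ x ∈ P.domain, 0 < x → h x = 0 := by
    intro x hx hx0
    have hi (i : Fin 2) := intervalIntegrable_C_mul_of_g hν hν' hc (fun x hx => (hh x hx).1)
      hx hx0 i
    let φ : ℝ → ℂ × ℂ := fun y => (-∫ t in P.a..y, P.C 1 t lam * P.q t * h t,
      ∫ t in P.a..y, P.C 0 t lam * P.q t * h t)
    have hφc : ContinuousOn φ (Set.uIcc P.a x) :=
      (intervalIntegral.continuousOn_primitive_interval' (hi 1) Set.left_mem_uIcc).neg.prodMk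
        (intervalIntegral.continuousOn_primitive_interval' (hi 0) Set.left_mem_uIcc)
    have hφ : ∀ y ∈ Set.uIcc P.a x, y ≠ P.a →
        h y = (φ y).1 * P.C 0 y lam + (φ y).2 * P.C 1 y lam := by
      intro y hy hya
      have hy' (i : Fin 2) := (hi i).mono_set (Set.uIcc_subset_uIcc_left hy)
      rw [(hh y (mem_domain_of_mem_uIcc ha hx hy hya)).2]
      have e : ∀ t, P.g y t lam * P.q t * h t = P.C 1 y lam * (P.C 0 t lam * P.q t * h t) -
          P.C 0 y lam * (P.C 1 t lam * P.q t * h t) := fun t => by rw [g]; ring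
      simp only [e]
      rw [intervalIntegral.integral_sub ((hy' 0).const_mul _) ((hy' 1).const_mul _),
        intervalIntegral.integral_const_mul, intervalIntegral.integral_const_mul]
      simp only [φ]
      ring
    have hN := hq.intervalIntegrable_system hν hν' lam
    have key : φ x = 0 := by
      refine eq_zero_of_eq_integral_clm_apply (hN P.a x) hφc fun y hy => ?_
      have hsub : Set.uIcc P.a y ⊆ Set.uIcc P.a x := Set.uIcc_subset_uIcc_left hy
      have hNφ := intervalIntegrable_clm_apply (hN P.a y) (hφc.mono hsub)
      have hae : ∀ᵐ t : ℝ, t ∈ Set.uIoc P.a y → P.system lam t (φ t) =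
          (-(P.C 1 t lam * P.q t * h t), P.C 0 t lam * P.q t * h t) := by
        filter_upwards [hne] with t hta ht
        have ht' := hsub (Set.uIoc_subset_uIcc ht)
        rw [system_apply P lam (uIcc_a_subset ha hx ht'), hφ t ht' hta]
      refine Prod.ext ?_ ?_
      · have := (ContinuousLinearMap.fst ℂ ℂ ℂ).intervalIntegral_comp_comm hNφ
        simp only [ContinuousLinearMap.coe_fst'] at this
        rw [← this]
        simp only [φ]
        rw [← intervalIntegral.integral_neg]
        refine intervalIntegral.integral_congr_ae ?_
        filter_upwards [hae] with t ht htm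
        rw [ht htm]
      · have := (ContinuousLinearMap.snd ℂ ℂ ℂ).intervalIntegral_comp_comm hNφ
        simp only [ContinuousLinearMap.coe_snd'] at this
        rw [← this]
        refine intervalIntegral.integral_congr_ae ?_
        filter_upwards [hae] with t ht htm
        rw [ht htm]
    rw [hφ x Set.right_mem_uIcc hx.2, key]
    simp
  intro x hx
  -- At x = 0 the integral equation itself gives the claim, since h is already zero almost
  -- everywhere under the integral.
  rcases hx.1.eq_or_lt with h0 | h0
  · rw [(hh x hx).2, ← intervalIntegral.integral_zero (μ := volume) (a := P.a) (b := x)]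
    refine intervalIntegral.integral_congr_ae ?_
    filter_upwards [hne] with t hta ht
    have ht' := mem_domain_of_mem_uIcc ha hx (Set.uIoc_subset_uIcc ht) hta
    have ht0 : 0 < t := by
      rw [Set.uIoc_of_ge (by linarith), ← h0] at ht
      exact ht.1
    rw [hpos t ht' ht0, mul_zero]
  · exact hpos x hx h0

/-- Differences solve the homogeneous equation. This makes the choice in `s` irrelevant on the
domain. -/
theorem IsIntegralSolution.unique (ha : 0 < P.a) (hν : 0 < P.ν.re)
    (hν' : ∀ n : ℕ, 1 ≤ n → P.ν ≠ (n : ℂ)) (hc : P.c 0 * P.c 1 = (2 * P.ν)⁻¹)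
    (hq : P.PotentialClass) {lam : ℂ} {j : Fin 2} {f g : ℝ → ℂ}
    (hf : P.IsIntegralSolution j lam f) (hg : P.IsIntegralSolution j lam g) :
    ∀ x ∈ P.domain, f x = g x := by
  intro x hx
  refine sub_eq_zero.1 (eq_zero_of_homogeneous (lam := lam) (h := fun x => f x - g x) ha hν hν' hc hq
    (fun y hy => ?_) x hx)
  obtain ⟨i1, e1⟩ := hf y hy
  obtain ⟨i2, e2⟩ := hg y hy
  refine ⟨(i1.sub i2).congr fun t _ => (mul_sub _ _ _).symm, ?_⟩
  simp only [mul_sub]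
  rw [intervalIntegral.integral_sub i1 i2]
  linear_combination e1 - e2

/-- The solution `s_j` as a combination of `C_1`, `C_2` with absolutely continuous coefficients. -/
theorem exists_s_eq (ha : 0 < P.a) (hν : 0 < P.ν.re)
    (hν' : ∀ n : ℕ, 1 ≤ n → P.ν ≠ (n : ℂ)) (hc : P.c 0 * P.c 1 = (2 * P.ν)⁻¹)
    (hq : P.PotentialClass) (lam : ℂ) (j : Fin 2) : ∃ u v : ℝ → ℂ,
      u P.a = (if j = 0 then 1 else 0) ∧ v P.a = (if j = 0 then 0 else 1) ∧
      IsPrimitiveOn (Set.Ici 0) u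
        (fun t => -(P.C 1 t lam * P.q t * (u t * P.C 0 t lam + v t * P.C 1 t lam))) ∧
      IsPrimitiveOn (Set.Ici 0) v
        (fun t => P.C 0 t lam * P.q t * (u t * P.C 0 t lam + v t * P.C 1 t lam)) ∧
      ∀ x ∈ P.domain, P.s j x lam = u x * P.C 0 x lam + v x * P.C 1 x lam := by
  have hN := hq.intervalIntegrable_system hν hν' lam
  obtain ⟨U, hUc, hU⟩ := exists_continuous_eq_add_integral_clm_apply hN P.a
    ((if j = 0 then 1 else 0, if j = 0 then 0 else 1) : ℂ × ℂ)
  have hUi (x y : ℝ) := intervalIntegrable_clm_apply (hN x y) hUc.continuousOn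
  have hUa : U P.a = (if j = 0 then 1 else 0, if j = 0 then 0 else 1) := by simpa using hU P.a
  have hprim : IsPrimitiveOn Set.univ U (fun t => P.system lam t (U t)) := fun x _ y _ =>
    ⟨hUi x y, by
      rw [hU x, hU y, add_sub_add_left_eq_sub,
        intervalIntegral.integral_interval_sub_left (hUi _ _) (hUi _ _)]⟩
  have hu : IsPrimitiveOn (Set.Ici 0) (fun t => (U t).1) (fun t =>
      -(P.C 1 t lam * P.q t * ((U t).1 * P.C 0 t lam + (U t).2 * P.C 1 t lam))) := by
    refine IsPrimitiveOn.congr (f := fun t => (P.system lam t (U t)).1) (F := fun t => (U t).1)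
      (fun x _ y _ => ?_) Set.ordConnected_Ici (fun _ _ => rfl)
      fun t ht => by rw [system_apply P lam ht]
    have := (ContinuousLinearMap.fst ℂ ℂ ℂ).intervalIntegral_comp_comm (hUi x y)
    simp only [ContinuousLinearMap.coe_fst'] at this
    rw [this, ← (hprim x trivial y trivial).2]
    exact ⟨⟨(hUi x y).1.fst, (hUi x y).2.fst⟩, rfl⟩
  have hv : IsPrimitiveOn (Set.Ici 0) (fun t => (U t).2) (fun t =>
      P.C 0 t lam * P.q t * ((U t).1 * P.C 0 t lam + (U t).2 * P.C 1 t lam)) := by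
    refine IsPrimitiveOn.congr (f := fun t => (P.system lam t (U t)).2) (F := fun t => (U t).2)
      (fun x _ y _ => ?_) Set.ordConnected_Ici (fun _ _ => rfl)
      fun t ht => by rw [system_apply P lam ht]
    have := (ContinuousLinearMap.snd ℂ ℂ ℂ).intervalIntegral_comp_comm (hUi x y)
    simp only [ContinuousLinearMap.coe_snd'] at this
    rw [this, ← (hprim x trivial y trivial).2]
    exact ⟨⟨(hUi x y).1.snd, (hUi x y).2.snd⟩, rfl⟩
  have hUa1 : (U P.a).1 = if j = 0 then 1 else 0 := by rw [hUa]
  have hUa2 : (U P.a).2 = if j = 0 then 0 else 1 := by rw [hUa]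
  have hsol : P.IsIntegralSolution j lam
      (fun x => (U x).1 * P.C 0 x lam + (U x).2 * P.C 1 x lam) := by
    intro x hx
    obtain ⟨i1, e1⟩ := hu P.a ha.le x hx.1
    obtain ⟨i2, e2⟩ := hv P.a ha.le x hx.1
    have e : ∀ t, P.g x t lam * P.q t * ((U t).1 * P.C 0 t lam + (U t).2 * P.C 1 t lam) =
        P.C 1 x lam * (P.C 0 t lam * P.q t * ((U t).1 * P.C 0 t lam + (U t).2 * P.C 1 t lam)) +
        P.C 0 x lam * -(P.C 1 t lam * P.q t * ((U t).1 * P.C 0 t lam + (U t).2 * P.C 1 t lam)) :=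
      fun t => by rw [g]; ring
    simp only [e]
    refine ⟨(i2.const_mul _).add (i1.const_mul _), ?_⟩
    rw [intervalIntegral.integral_add (i2.const_mul _) (i1.const_mul _),
      intervalIntegral.integral_const_mul, intervalIntegral.integral_const_mul, ← e1, ← e2]
    simp only [hUa1, hUa2]
    fin_cases j
    · simp; ring
    · simp; ring
  refine ⟨fun t => (U t).1, fun t => (U t).2, hUa1, hUa2, hu, hv, ?_⟩
  exact (Classical.epsilon_spec (p := fun f => P.IsIntegralSolution j lam f)
    ⟨_, hsol⟩).unique ha hν hν' hc hq hsol

/-- The coefficient `ν₀ / (x - a)² + q(x) - λ` of the equation `y'' = V y`. -/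
def V (P : BesselSL) (lam : ℂ) (t : ℝ) : ℂ := P.ν₀ / ((t - P.a : ℝ) : ℂ) ^ 2 + P.q t - lam

/-- `s_1`, `s_2` solve the differential equation and have Wronskian `1`. -/
theorem exists_isSolutionOn_s (ha : 0 < P.a) (hν : 0 < P.ν.re)
    (hν' : ∀ n : ℕ, 1 ≤ n → P.ν ≠ (n : ℂ)) (hc : P.c 0 * P.c 1 = (2 * P.ν)⁻¹)
    (hq : P.PotentialClass) (lam : ℂ) : ∃ s' : Fin 2 → ℝ → ℂ,
      (∀ (j : Fin 2) (S : Set ℝ), S.OrdConnected → S ⊆ P.domain →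
        IsSolutionOn (P.V lam) S (fun x => P.s j x lam) (s' j)) ∧
      ∀ x ∈ P.domain, P.s 0 x lam * s' 1 x - s' 0 x * P.s 1 x lam = 1 := by
  choose u v hu0 hv0 hu hv hs using exists_s_eq ha hν hν' hc hq lam
  -- Variation of constants: u' C₁ + v' C₂ = 0, so the derivative involves no derivative of the
  -- coefficients.
  refine ⟨fun j x => u j x * P.C' 0 x lam + v j x * P.C' 1 x lam, fun j S hS hSd => ?_,
    fun x hx => ?_⟩
  · have hSa : S ⊆ {P.a}ᶜ := fun x hx => (hSd hx).2
    have hS0 : S ⊆ Set.Ici 0 := fun x hx => (hSd hx).1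
    have hC (i : Fin 2) : IsPrimitiveOn S (fun x => P.C i x lam) (fun x => P.C' i x lam) :=
      .of_hasDerivAt hS (fun x hx => hasDerivAt_C hν hν' i lam (hSa hx))
        ((continuousOn_C' hν hν' i lam).mono hSa)
    have hC' (i : Fin 2) : IsPrimitiveOn S (fun x => P.C' i x lam)
        (fun x => (P.ν₀ / ((x - P.a : ℝ) : ℂ) ^ 2 - lam) * P.C i x lam) :=
      .of_hasDerivAt hS (fun x hx => hasDerivAt_C' hν hν' i lam (hSa hx))
        (((P.continuousOn_const_div_sub_sq lam).mul (continuousOn_C hν hν' i lam)).mono hSa)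
    have hu' := (hu j).mono hS0
    have hv' := (hv j).mono hS0
    constructor
    · refine ((hu'.mul (hC 0) hS).add (hv'.mul (hC 1) hS)).congr hS (fun x hx => hs j x (hSd hx))
        fun x _ => ?_
      ring
    · refine ((hu'.mul (hC' 0) hS).add (hv'.mul (hC' 1) hS)).congr hS (fun _ _ => rfl)
        fun x hx => ?_
      have w := C_wronskian hν hν' hc lam (hSa hx)
      rw [hs j x (hSd hx), V]
      linear_combination (-(P.q x * (u j x * P.C 0 x lam + v j x * P.C 1 x lam))) * w
  -- The system has trace zero, so the determinant of the coefficient pairs stays at its value 1 at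
  -- `a`; the Wronskian of s₁, s₂ is this determinant times that of C₁, C₂.
  · have hd := ((hu 0).mul (hv 1) Set.ordConnected_Ici).add
      (((hv 0).mul (hu 1) Set.ordConnected_Ici).const_mul (-1)) P.a ha.le x hx.1
    have h0 : (∫ t in P.a..x, (0 : ℂ)) = 0 := intervalIntegral.integral_zero
    have hdet := hd.2.trans ((intervalIntegral.integral_congr fun t _ => by ring).trans h0)
    simp only [hu0, hv0] at hdet
    have w := C_wronskian hν hν' hc lam hx.2
    rw [hs 0 x hx, hs 1 x hx]
    norm_num at hdet
    linear_combination (u 0 x * v 1 x - v 0 x * u 1 x) * w + hdet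

end BesselSL

/-! ### Solutions with prescribed behaviour at infinity -/

theorem isPrimitiveOn_integral_Ioi {f : ℝ → ℂ} (hf : Integrable f) :
    IsPrimitiveOn Set.univ (fun x => ∫ t in Set.Ioi x, f t) (fun t => -f t) := by
  intro u _ v _
  refine ⟨hf.neg.intervalIntegrable, ?_⟩
  simp only
  rw [← intervalIntegral.integral_interval_add_Ioi hf.integrableOn hf.integrableOn
    (a := u) (b := v), intervalIntegral.integral_neg]
  ring

theorem IsPrimitiveOn.continuous {E : Type*} [NormedAddCommGroup E] [NormedSpace ℝ E]
    {F f : ℝ → E} (h : IsPrimitiveOn Set.univ F f) : Continuous F := by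
  refine continuous_iff_continuousAt.2 fun x => ?_
  have := h.continuousOn_uIcc (Set.mem_univ (x - 1)) (Set.mem_univ (x + 1)) Set.ordConnected_univ
  rw [Set.uIcc_of_le (by linarith)] at this
  exact this.continuousAt (Icc_mem_nhds (by linarith) (by linarith))

theorem tendsto_integral_Ioi_zero {E : Type*} [NormedAddCommGroup E] [NormedSpace ℝ E]
    {f : ℝ → E} {X : ℝ} (hf : IntegrableOn f (Set.Ioi X)) :
    Tendsto (fun x => ∫ t in Set.Ioi x, f t) atTop (𝓝 0) := by
  have h := (intervalIntegral_tendsto_integral_Ioi X hf tendsto_id).const_sub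
    (∫ t in Set.Ioi X, f t)
  rw [sub_self] at h
  refine h.congr' ?_
  filter_upwards [eventually_ge_atTop X] with x hx
  rw [id, ← intervalIntegral.integral_interval_add_Ioi hf (hf.mono_set (Set.Ioi_subset_Ioi hx))]
  abel

theorem norm_exp_I_mul (ρ : ℂ) (x : ℝ) :
    ‖Complex.exp (Complex.I * ρ * x)‖ = Real.exp (-(ρ.im * x)) := by
  rw [Complex.norm_exp]
  simp

/-- The Volterra operator of the Jost solution: for `w = y exp(-iρx)` the equation
`y'' = (Q - ρ²) y` becomes `w = 1 + jostOperator Q ρ w`. -/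
def jostOperator (Q : ℝ → ℂ) (ρ : ℂ) (w : ℝ → ℂ) (x : ℝ) : ℂ :=
  (2 * Complex.I * ρ)⁻¹ * (Complex.exp (-(2 * (Complex.I * ρ * x))) *
    (∫ t in Set.Ioi x, Complex.exp (2 * (Complex.I * ρ * t)) * (Q t * w t)) -
    ∫ t in Set.Ioi x, Q t * w t)

section jostOperator

variable {Q w w₁ w₂ : ℝ → ℂ} {ρ : ℂ} {X B : ℝ}

theorem integrable_mul_of_bounded (hQ : Integrable Q) (hw : Continuous w) (hB : ∀ t, ‖w t‖ ≤ B) :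
    Integrable fun t => Q t * w t := by
  refine (hQ.norm.mul_const B).mono' (hQ.aestronglyMeasurable.mul hw.aestronglyMeasurable)
    (.of_forall fun t => ?_)
  rw [norm_mul]
  exact mul_le_mul_of_nonneg_left (hB t) (norm_nonneg _)

/-- The exponential may grow to the left, which is why the function has to vanish below some X. -/
theorem integrable_exp_mul (hf : Integrable Q) (hX : ∀ t ≤ X, Q t = 0) (hρ : 0 ≤ ρ.im) :
    Integrable fun t : ℝ => Complex.exp (2 * (Complex.I * ρ * t)) * Q t := by
  refine (hf.norm.const_mul (Real.exp (-(2 * (ρ.im * X))))).mono'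
    ((by fun_prop : Continuous fun t : ℝ =>
      Complex.exp (2 * (Complex.I * ρ * t))).aestronglyMeasurable.mul hf.aestronglyMeasurable)
    (.of_forall fun t => ?_)
  rcases le_total t X with h | h
  · simp [hX t h]
  · rw [norm_mul]
    refine mul_le_mul_of_nonneg_right ?_ (norm_nonneg _)
    rw [Complex.norm_exp, Real.exp_le_exp]
    simp
    exact mul_le_mul_of_nonneg_left h hρ

theorem continuous_jostOperator (hQ : Integrable Q) (hX : ∀ t ≤ X, Q t = 0) (hρ : 0 ≤ ρ.im)
    (hw : Continuous w) (hB : ∀ t, ‖w t‖ ≤ B) : Continuous (jostOperator Q ρ w) := by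
  have h := integrable_mul_of_bounded hQ hw hB
  have c1 := (isPrimitiveOn_integral_Ioi h).continuous
  have c2 := (isPrimitiveOn_integral_Ioi (integrable_exp_mul (X := X) h
    (fun t ht => by rw [hX t ht, zero_mul]) hρ)).continuous
  unfold jostOperator
  fun_prop

theorem jostOperator_sub (hQ : Integrable Q) (hX : ∀ t ≤ X, Q t = 0) (hρ : 0 ≤ ρ.im)
    (hw₁ : Continuous w₁) (hB₁ : ∀ t, ‖w₁ t‖ ≤ B) (hw₂ : Continuous w₂) (hB₂ : ∀ t, ‖w₂ t‖ ≤ B)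
    (x : ℝ) : jostOperator Q ρ w₁ x - jostOperator Q ρ w₂ x =
      jostOperator Q ρ (fun t => w₁ t - w₂ t) x := by
  have h1 := integrable_mul_of_bounded hQ hw₁ hB₁
  have h2 := integrable_mul_of_bounded hQ hw₂ hB₂
  have e1 := integrable_exp_mul (X := X) h1 (fun t ht => by rw [hX t ht, zero_mul]) hρ
  have e2 := integrable_exp_mul (X := X) h2 (fun t ht => by rw [hX t ht, zero_mul]) hρ
  simp only [jostOperator, mul_sub]
  rw [integral_sub e1.integrableOn e2.integrableOn, integral_sub h1.integrableOn h2.integrableOn]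
  ring

/-- The kernel is (exp(2iρ(t - x)) - 1) / (2iρ) with t > x, bounded by 1/|ρ| as soon as Im ρ ≥ 0;
real ρ is therefore allowed. -/
theorem norm_jostOperator_le (hQ : Integrable Q) (hX : ∀ t ≤ X, Q t = 0) (hρ : 0 ≤ ρ.im)
    (hw : Continuous w) (hB : ∀ t, ‖w t‖ ≤ B) (x : ℝ) :
    ‖jostOperator Q ρ w x‖ ≤ ‖ρ‖⁻¹ * (B * ∫ t in Set.Ioi x, ‖Q t‖) := by
  have h := integrable_mul_of_bounded hQ hw hB
  have he := integrable_exp_mul (X := X) h (fun t ht => by rw [hX t ht, zero_mul]) hρ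
  rw [jostOperator, ← integral_const_mul, ← integral_sub (he.const_mul _).integrableOn
    h.integrableOn, norm_mul, norm_inv, norm_mul, norm_mul, Complex.norm_I, mul_one,
    ← integral_const_mul B]
  have h2 : ‖∫ t in Set.Ioi x, (Complex.exp (-(2 * (Complex.I * ρ * x))) *
      (Complex.exp (2 * (Complex.I * ρ * t)) * (Q t * w t)) - Q t * w t)‖ ≤
      ∫ t in Set.Ioi x, 2 * (B * ‖Q t‖) := by
    refine norm_integral_le_of_norm_le ((hQ.norm.const_mul B).const_mul 2).integrableOn ?_
    filter_upwards [ae_restrict_mem measurableSet_Ioi] with t ht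
    have e : Complex.exp (-(2 * (Complex.I * ρ * x))) *
        (Complex.exp (2 * (Complex.I * ρ * t)) * (Q t * w t)) - Q t * w t =
        (Complex.exp (2 * (Complex.I * ρ * ((t - x : ℝ) : ℂ))) - 1) * (Q t * w t) := by
      rw [← mul_assoc, ← Complex.exp_add]
      push_cast
      ring_nf
    rw [e, norm_mul, norm_mul, mul_comm B]
    have h1 : ‖Complex.exp (2 * (Complex.I * ρ * ((t - x : ℝ) : ℂ))) - 1‖ ≤ 2 := by
      refine (norm_sub_le _ _).trans ?_
      rw [norm_one, Complex.norm_exp]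
      have : Real.exp (2 * (Complex.I * ρ * ((t - x : ℝ) : ℂ))).re ≤ 1 := by
        rw [Real.exp_le_one_iff]
        have : 0 ≤ ρ.im * (t - x) := mul_nonneg hρ (sub_nonneg.2 (le_of_lt ht))
        simp
        simpa using this
      linarith
    exact mul_le_mul h1 (mul_le_mul_of_nonneg_left (hB t) (norm_nonneg _)) (by positivity)
      (by norm_num)
  rw [integral_const_mul] at h2
  have h4 : ‖(2 : ℂ)‖ = 2 := by norm_num
  rw [h4]
  calc (2 * ‖ρ‖)⁻¹ * _ ≤ (2 * ‖ρ‖)⁻¹ * (2 * ∫ t in Set.Ioi x, B * ‖Q t‖) := by gcongr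
    _ = _ := by rw [mul_inv]; ring

/-- Under the smallness condition the map is a contraction with constant 1/2 on bounded continuous
functions. -/
theorem exists_eq_one_add_jostOperator (hQ : Integrable Q) (hX : ∀ t ≤ X, Q t = 0)
    (hρ : 0 ≤ ρ.im) (hsmall : ‖ρ‖⁻¹ * ∫ t, ‖Q t‖ ≤ 1 / 2) :
    ∃ w : ℝ → ℂ, Continuous w ∧ (∃ B, ∀ t, ‖w t‖ ≤ B) ∧ ∀ x, w x = 1 + jostOperator Q ρ w x := by
  have hb {w : ℝ → ℂ} {B : ℝ} (hw : Continuous w) (hB : ∀ t, ‖w t‖ ≤ B) (x : ℝ) :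
      ‖jostOperator Q ρ w x‖ ≤ 1 / 2 * B := by
    have hB0 : 0 ≤ B := (norm_nonneg _).trans (hB 0)
    refine (norm_jostOperator_le hQ hX hρ hw hB x).trans ?_
    have : ∫ t in Set.Ioi x, ‖Q t‖ ≤ ∫ t, ‖Q t‖ :=
      setIntegral_le_integral hQ.norm (.of_forall fun _ => norm_nonneg _)
    calc ‖ρ‖⁻¹ * (B * ∫ t in Set.Ioi x, ‖Q t‖) ≤ ‖ρ‖⁻¹ * (B * ∫ t, ‖Q t‖) := by gcongr
      _ = (‖ρ‖⁻¹ * ∫ t, ‖Q t‖) * B := by ring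
      _ ≤ 1 / 2 * B := by gcongr
  let T : BoundedContinuousFunction ℝ ℂ → BoundedContinuousFunction ℝ ℂ := fun w =>
    BoundedContinuousFunction.ofNormedAddCommGroup (fun x => 1 + jostOperator Q ρ w x)
      (continuous_const.add (continuous_jostOperator hQ hX hρ w.continuous w.norm_coe_le_norm))
      (1 + 1 / 2 * ‖w‖) fun x => (norm_add_le _ _).trans (by
        rw [norm_one]
        have := hb w.continuous w.norm_coe_le_norm x
        linarith)
  have hT : ContractingWith (1 / 2) T := by
    refine ⟨by rw [← NNReal.coe_lt_coe]; norm_num, LipschitzWith.of_dist_le_mul fun w₁ w₂ => ?_⟩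
    rw [BoundedContinuousFunction.dist_le (by positivity)]
    intro x
    have hB : ∀ t, ‖w₁ t - w₂ t‖ ≤ dist w₁ w₂ := fun t => by
      rw [← dist_eq_norm]
      exact BoundedContinuousFunction.dist_coe_le_dist t
    have h1 (t : ℝ) : ‖w₁ t‖ ≤ max ‖w₁‖ ‖w₂‖ := (w₁.norm_coe_le_norm t).trans (le_max_left _ _)
    have h2 (t : ℝ) : ‖w₂ t‖ ≤ max ‖w₁‖ ‖w₂‖ := (w₂.norm_coe_le_norm t).trans (le_max_right _ _)
    have e := jostOperator_sub hQ hX hρ w₁.continuous h1 w₂.continuous h2 x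
    have h3 := hb (w := fun t => w₁ t - w₂ t) (w₁.continuous.sub w₂.continuous) hB x
    rw [dist_eq_norm]
    simp only [T, BoundedContinuousFunction.coe_ofNormedAddCommGroup, add_sub_add_left_eq_sub]
    rw [e]
    simpa using h3
  obtain ⟨w, hw⟩ : ∃ w, T w = w := ⟨ContractingWith.fixedPoint T hT, hT.fixedPoint_isFixedPt⟩
  exact ⟨w, w.continuous, ⟨_, w.norm_coe_le_norm⟩, fun x => (DFunLike.congr_fun hw x).symm⟩

end jostOperator

theorem isPrimitiveOn_exp (z : ℂ) :
    IsPrimitiveOn Set.univ (fun x : ℝ => Complex.exp (z * x))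
      (fun x : ℝ => z * Complex.exp (z * x)) := by
  refine .of_hasDerivAt Set.ordConnected_univ (fun x _ => ?_) (by fun_prop)
  have h : HasDerivAt (fun x : ℝ => z * (x : ℂ)) z x := by
    simpa using (hasDerivAt_id x).ofReal_comp.const_mul z
  exact h.cexp.congr_deriv (mul_comm _ _)

/-- Existence of the Jost solution of `y'' = (Q - ρ²) y` near infinity. -/
theorem exists_jostSolution {Q : ℝ → ℂ} {X : ℝ} (hQ : IntegrableOn Q (Set.Ioi X)) {ρ : ℂ}
    (hρ : ρ ≠ 0) (hρ' : 0 ≤ ρ.im) : ∃ X' ≥ X, ∃ y y' : ℝ → ℂ,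
      IsSolutionOn (fun t => Q t - ρ ^ 2) (Set.Ioi X') y y' ∧
      Tendsto (fun x : ℝ => y x * Complex.exp (-(Complex.I * ρ * x))) atTop (𝓝 1) := by
  have hρn : 0 < ‖ρ‖ := norm_pos_iff.2 hρ
  -- The starting point is moved so far out that the tail of Q has norm at most |ρ|/2; the indicator
  -- then makes the problem global.
  obtain ⟨X', hX', hXX'⟩ := (((tendsto_integral_Ioi_zero hQ.norm).eventually_le_const
    (by positivity : 0 < ‖ρ‖ / 2)).and (eventually_ge_atTop X)).exists
  have hQ' : Integrable ((Set.Ioi X').indicator Q) :=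
    (hQ.mono_set (Set.Ioi_subset_Ioi hXX')).integrable_indicator measurableSet_Ioi
  have hz : ∀ t ≤ X', (Set.Ioi X').indicator Q t = 0 := fun t ht =>
    Set.indicator_of_notMem (by simpa using ht) _
  have hsmall : ‖ρ‖⁻¹ * ∫ t, ‖(Set.Ioi X').indicator Q t‖ ≤ 1 / 2 := by
    simp only [norm_indicator_eq_indicator_norm]
    rw [integral_indicator measurableSet_Ioi, inv_mul_le_iff₀ hρn]
    linarith
  obtain ⟨w, hwc, ⟨B, hB⟩, hw⟩ := exists_eq_one_add_jostOperator hQ' hz hρ' hsmall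
  set Q' := (Set.Ioi X').indicator Q with hQ'def
  have hi := integrable_mul_of_bounded hQ' hwc hB
  have hie := integrable_exp_mul (X := X') hi (fun t ht => by rw [hz t ht, zero_mul]) hρ'
  have pA := isPrimitiveOn_integral_Ioi hie
  have pB := isPrimitiveOn_integral_Ioi hi
  have pp := isPrimitiveOn_exp (Complex.I * ρ)
  have pm := isPrimitiveOn_exp (-(Complex.I * ρ))
  set A : ℝ → ℂ := fun x => ∫ t in Set.Ioi x, Complex.exp (2 * (Complex.I * ρ * t)) * (Q' t * w t)
  set D : ℝ → ℂ := fun x => ∫ t in Set.Ioi x, Q' t * w t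
  have u := Set.ordConnected_univ (α := ℝ)
  have hI : (2 * Complex.I * ρ)⁻¹ * (Complex.I * ρ) = 1 / 2 := by
    have := Complex.I_ne_zero
    field_simp
  have hexp (x : ℝ) : Complex.exp (-(Complex.I * ρ) * x) * Complex.exp (2 * (Complex.I * ρ * x)) =
      Complex.exp (Complex.I * ρ * x) := by
    rw [← Complex.exp_add]; ring_nf
  have hexp2 (x : ℝ) : Complex.exp (-(Complex.I * ρ) * x) * Complex.exp (Complex.I * ρ * x) = 1 := by
    rw [← Complex.exp_add]; simp
  have hexp3 (x : ℝ) : Complex.exp (-(2 * (Complex.I * ρ * x))) =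
      Complex.exp (-(Complex.I * ρ) * x) * Complex.exp (-(Complex.I * ρ) * x) := by
    rw [← Complex.exp_add]; ring_nf
  let y : ℝ → ℂ := fun x => Complex.exp (Complex.I * ρ * x) + (2 * Complex.I * ρ)⁻¹ *
    (Complex.exp (-(Complex.I * ρ) * x) * A x + -1 * (Complex.exp (Complex.I * ρ * x) * D x))
  -- In differentiating `y`, the two terms coming from the lower limits of the integrals cancel; in
  -- differentiating `y'` they add up to Q y.
  let y' : ℝ → ℂ := fun x => Complex.I * ρ * Complex.exp (Complex.I * ρ * x) + -(1 / 2) *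
    (Complex.exp (-(Complex.I * ρ) * x) * A x + Complex.exp (Complex.I * ρ * x) * D x)
  have hyw (x : ℝ) : y x = Complex.exp (Complex.I * ρ * x) * w x := by
    rw [hw x, jostOperator, hexp3]
    simp only [y]
    linear_combination (-(2 * Complex.I * ρ)⁻¹ * Complex.exp (-(Complex.I * ρ) * x) * A x) * hexp2 x
  refine ⟨X', hXX', y, y', ⟨?_, ?_⟩, ?_⟩
  · refine IsPrimitiveOn.mono (IsPrimitiveOn.congr (pp.add (((pm.mul pA u).add
      ((pp.mul pB u).const_mul (-1))).const_mul (2 * Complex.I * ρ)⁻¹)) u (fun _ _ => rfl)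
      fun x _ => ?_) (Set.subset_univ _)
    simp only [y']
    linear_combination (2 * Complex.I * ρ)⁻¹ * (Q' x * w x) * hexp x +
      (Complex.exp (-(Complex.I * ρ) * x) * A x + Complex.exp (Complex.I * ρ * x) * D x) * hI
  · refine IsPrimitiveOn.congr (((pp.const_mul (Complex.I * ρ)).add (((pm.mul pA u).add
      (pp.mul pB u)).const_mul (-(1 / 2)))).mono (Set.subset_univ _)) Set.ordConnected_Ioi
      (fun _ _ => rfl) fun x hx => ?_
    have hQx : Q' x = Q x := Set.indicator_of_mem hx Q
    have hI2 : Complex.I ^ 2 = -1 := Complex.I_sq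
    have hyx := hyw x
    simp only [y] at hyx ⊢
    linear_combination Q x * hyx + (Complex.exp (-(Complex.I * ρ) * x) * A x -
      Complex.exp (Complex.I * ρ * x) * D x) * (Complex.I * ρ) * hI -
      ((2 * Complex.I * ρ)⁻¹ * ρ ^ 2 * (Complex.exp (-(Complex.I * ρ) * x) * A x -
      Complex.exp (Complex.I * ρ * x) * D x) + ρ ^ 2 * Complex.exp (Complex.I * ρ * x)) * hI2 -
      1 / 2 * (Q' x * w x) * hexp x - Complex.exp (Complex.I * ρ * x) * w x * hQx
  · have hlim : Tendsto w atTop (𝓝 1) := by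
      rw [tendsto_iff_norm_sub_tendsto_zero]
      have h0 := ((tendsto_integral_Ioi_zero (X := X') hQ'.norm.integrableOn).const_mul B).const_mul
        ‖ρ‖⁻¹
      simp only [mul_zero] at h0
      refine squeeze_zero (fun _ => norm_nonneg _) (fun x => ?_) h0
      rw [hw x, add_sub_cancel_left]
      exact norm_jostOperator_le hQ' hz hρ' hwc hB x
    refine hlim.congr fun x => ?_
    rw [hyw, ← neg_mul]
    linear_combination (-w x) * hexp2 x

/-- The derivative of a solution of `y'' = (Q - ρ²) y` with integrable `Q` is bounded near infinity
by a multiple of any bound of the solution. -/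
theorem IsSolutionOn.exists_eventually_norm_deriv_le {Q : ℝ → ℂ} {X : ℝ}
    (hQ : IntegrableOn Q (Set.Ioi X)) (lam : ℂ) : ∃ K : ℝ, 0 ≤ K ∧ ∀ y y' : ℝ → ℂ,
      IsSolutionOn (fun t => Q t - lam) (Set.Ioi X) y y' → ∀ B : ℝ,
      (∀ᶠ x in atTop, ‖y x‖ ≤ B) → ∀ᶠ x in atTop, ‖y' x‖ ≤ K * B := by
  -- The constant does not depend on the solution or on `B`, so an arbitrarily small `B` may be
  -- inserted for a decaying solution.
  refine ⟨2 + ((∫ t in Set.Ioi X, ‖Q t‖) + ‖lam‖), by positivity, fun y y' hy B hB => ?_⟩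
  obtain ⟨x₀, hx₀⟩ := eventually_atTop.1 hB
  filter_upwards [eventually_ge_atTop x₀, eventually_gt_atTop X] with x hx hxX
  have hsub : Set.Ioc x (x + 1) ⊆ Set.Ioi X := fun t ht => hxX.trans ht.1
  have hle : x ≤ x + 1 := by linarith
  have hQx : IntervalIntegrable Q volume x (x + 1) :=
    (intervalIntegrable_iff_integrableOn_Ioc_of_le hle).2 (hQ.mono_set hsub)
  refine hy.norm_deriv_le Set.ordConnected_Ioi hxX (hxX.trans (by simp))
    (fun t ht => hx₀ t (hx.trans ht.1)) (hQx.sub intervalIntegrable_const) ?_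
  calc ∫ t in x..(x + 1), ‖Q t - lam‖ ≤ ∫ t in x..(x + 1), (‖Q t‖ + ‖lam‖) :=
        intervalIntegral.integral_mono_on hle (hQx.sub intervalIntegrable_const).norm
          (hQx.norm.add intervalIntegrable_const) fun t _ => norm_sub_le _ _
    _ = (∫ t in x..(x + 1), ‖Q t‖) + ‖lam‖ := by
        rw [intervalIntegral.integral_add hQx.norm intervalIntegrable_const]
        simp
    _ ≤ _ := by
        gcongr
        rw [intervalIntegral.integral_of_le hle]
        exact setIntegral_mono_set hQ.norm (.of_forall fun _ => norm_nonneg _) hsub.eventuallyLE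

/-- A solution vanishing at infinity has zero Wronskian with the Jost solution. -/
theorem IsSolutionOn.wronskian_eq_zero {Q : ℝ → ℂ} {X : ℝ} (hQ : IntegrableOn Q (Set.Ioi X))
    {ρ : ℂ} (hρ : 0 ≤ ρ.im) {y y' z z' : ℝ → ℂ}
    (hy : IsSolutionOn (fun t => Q t - ρ ^ 2) (Set.Ioi X) y y')
    (hz : IsSolutionOn (fun t => Q t - ρ ^ 2) (Set.Ioi X) z z') (hy0 : Tendsto y atTop (𝓝 0))
    (hz1 : Tendsto (fun x : ℝ => z x * Complex.exp (-(Complex.I * ρ * x))) atTop (𝓝 1))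
    {x : ℝ} (hx : X < x) : y x * z' x - y' x * z x = 0 := by
  obtain ⟨K, hK0, hK⟩ := IsSolutionOn.exists_eventually_norm_deriv_le hQ (ρ ^ 2)
  have hzb : ∀ᶠ x in atTop, ‖z x‖ ≤ 2 := by
    filter_upwards [hz1.norm.eventually_le_const (by norm_num : ‖(1 : ℂ)‖ < 2),
      eventually_ge_atTop 0] with x h1 h2
    have e : z x = z x * Complex.exp (-(Complex.I * ρ * x)) * Complex.exp (Complex.I * ρ * x) := by
      rw [mul_assoc, ← Complex.exp_add]; simp
    have h3 : ‖Complex.exp (Complex.I * ρ * x)‖ ≤ 1 := by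
      rw [norm_exp_I_mul, Real.exp_le_one_iff]
      linarith [mul_nonneg hρ h2]
    rw [e, norm_mul]
    calc _ ≤ 2 * 1 := mul_le_mul h1 h3 (norm_nonneg _) (by norm_num)
      _ = 2 := by norm_num
  have hzb' := hK z z' hz 2 hzb
  refine norm_le_zero_iff.1 (le_of_forall_pos_le_add fun ε hε => ?_)
  -- At a far point |y| ≤ δ, |y'| ≤ Kδ, |z| ≤ 2, |z'| ≤ 2K, so the constant Wronskian is at most
  -- 4Kδ; the added 1 covers K = 0.
  have hδ : 0 < ε / (4 * K + 1) := by positivity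
  have hyb : ∀ᶠ x in atTop, ‖y x‖ ≤ ε / (4 * K + 1) :=
    hy0.norm.eventually_le_const (by simpa using hδ)
  have hyb' := hK y y' hy _ hyb
  obtain ⟨t, h1, h2, h3, h4, ht⟩ :=
    (hzb.and (hzb'.and (hyb.and (hyb'.and (eventually_gt_atTop X))))).exists
  rw [hy.wronskian_eq Set.ordConnected_Ioi hz hx ht, zero_add]
  refine (norm_sub_le _ _).trans ?_
  rw [norm_mul, norm_mul]
  calc ‖y t‖ * ‖z' t‖ + ‖y' t‖ * ‖z t‖
      ≤ ε / (4 * K + 1) * (K * 2) + K * (ε / (4 * K + 1)) * 2 := by gcongr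
    _ = ε * (4 * K / (4 * K + 1)) := by ring
    _ ≤ ε * 1 := by
        gcongr
        rw [div_le_one (by positivity)]
        linarith
    _ = ε := mul_one ε

theorem IsSolutionOn.congr {V : ℝ → ℂ} {S : Set ℝ} {y y' z z' : ℝ → ℂ} (h : IsSolutionOn V S y y')
    (hS : S.OrdConnected) (hz : ∀ x ∈ S, z x = y x) (hz' : ∀ x ∈ S, z' x = y' x) :
    IsSolutionOn V S z z' :=
  ⟨h.prim.congr hS hz hz', h.prim'.congr hS hz' fun x hx => by rw [hz x hx]⟩

theorem IsSolutionOn.hasDerivWithinAt {V : ℝ → ℂ} {S t : Set ℝ} {y y' : ℝ → ℂ} {u v x : ℝ}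
    (h : IsSolutionOn V S y y') (hS : S.OrdConnected) (hu : u ∈ S) (hv : v ∈ S)
    (hx : x ∈ Set.Icc u v) (ht : Set.Icc u v ∈ 𝓝[t] x) : HasDerivWithinAt y (y' x) t x := by
  have hc := h.prim'.continuousOn_uIcc hu hv hS
  rw [Set.uIcc_of_le (hx.1.trans hx.2)] at hc
  exact (h.prim.hasDerivWithinAt_Icc hS hu hv hx hc).mono_of_mem_nhdsWithin ht

/-! ### The Jost solution with the jump at `a` -/

namespace BesselSL

variable {P : BesselSL}

theorem comb_of_lt (P : BesselSL) (α : Fin 2 → ℂ) (lam : ℂ) {x : ℝ} (hx : x < P.a) :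
    P.comb α x lam = α 0 * P.s 0 x lam + α 1 * P.s 1 x lam := by
  simp [comb, σ, hx]

theorem comb_of_ge (P : BesselSL) (α : Fin 2 → ℂ) (lam : ℂ) {x : ℝ} (hx : P.a ≤ x) :
    P.comb α x lam = P.A.mulVec α 0 * P.s 0 x lam + P.A.mulVec α 1 * P.s 1 x lam := by
  simp only [comb, σ, hx.not_gt, if_false, Fin.sum_univ_two, Matrix.mulVec, dotProduct]
  ring

theorem comb_smul (P : BesselSL) (c : ℂ) (α : Fin 2 → ℂ) (x : ℝ) (lam : ℂ) :
    P.comb (c • α) x lam = c * P.comb α x lam := by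
  simp [comb, mul_add, mul_assoc]

/-- The part of `V` that is integrable at infinity. -/
def Q (P : BesselSL) (t : ℝ) : ℂ := P.ν₀ / ((t - P.a : ℝ) : ℂ) ^ 2 + P.q t

theorem PotentialClass.exists_integrableOn_Q (hq : P.PotentialClass) :
    ∃ T, P.a < T ∧ IntegrableOn P.Q (Set.Ioi T) := by
  obtain ⟨T, hT, -, h⟩ := hq
  refine ⟨T, hT, Integrable.add ?_ h⟩
  have h1 := (integrableOn_add_rpow_Ioi_of_lt (a := -2) (c := T) (m := -P.a) (by norm_num)
    (by linarith)).ofReal (𝕜 := ℂ)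
  refine (IntegrableOn.congr_fun (h1.const_mul P.ν₀) (fun t ht => ?_) measurableSet_Ioi)
  have : 0 ≤ t + -P.a := by have : T < t := ht; linarith
  rw [Real.rpow_neg this, div_eq_mul_inv, ← sub_eq_add_neg]
  norm_cast

theorem isSolutionOn_comb_left {lam : ℂ} {s' : Fin 2 → ℝ → ℂ} (hs : ∀ (j : Fin 2) (S : Set ℝ),
      S.OrdConnected → S ⊆ P.domain → IsSolutionOn (P.V lam) S (fun x => P.s j x lam) (s' j))
    (α : Fin 2 → ℂ) : IsSolutionOn (P.V lam) (Set.Ico 0 P.a) (fun x => P.comb α x lam)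
      (fun x => α 0 * s' 0 x + α 1 * s' 1 x) := by
  have hS : Set.Ico 0 P.a ⊆ P.domain := fun x hx => ⟨hx.1, hx.2.ne⟩
  exact ((hs 0 _ Set.ordConnected_Ico hS).linearCombination Set.ordConnected_Ico
    (hs 1 _ Set.ordConnected_Ico hS) (α 0) (α 1)).congr Set.ordConnected_Ico
    (fun x hx => P.comb_of_lt α lam hx.2) fun _ _ => rfl

theorem isSolutionOn_comb_right (ha : 0 < P.a) {lam : ℂ} {s' : Fin 2 → ℝ → ℂ}
    (hs : ∀ (j : Fin 2) (S : Set ℝ),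
      S.OrdConnected → S ⊆ P.domain → IsSolutionOn (P.V lam) S (fun x => P.s j x lam) (s' j))
    (α : Fin 2 → ℂ) : IsSolutionOn (P.V lam) (Set.Ioi P.a) (fun x => P.comb α x lam)
      (fun x => P.A.mulVec α 0 * s' 0 x + P.A.mulVec α 1 * s' 1 x) := by
  have hS : Set.Ioi P.a ⊆ P.domain := fun x hx => ⟨ha.le.trans (le_of_lt hx), hx.ne'⟩
  exact ((hs 0 _ Set.ordConnected_Ioi hS).linearCombination Set.ordConnected_Ioi
    (hs 1 _ Set.ordConnected_Ioi hS) _ _).congr Set.ordConnected_Ioi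
    (fun x hx => P.comb_of_ge α lam (le_of_lt hx)) fun _ _ => rfl

/-- The two sides are glued without any matching, because the notion of solution never crosses `a`.
Hence the differential equation in the definition of an eigenvalue holds automatically. -/
theorem isSolution_comb (ha : 0 < P.a) (hν : 0 < P.ν.re)
    (hν' : ∀ n : ℕ, 1 ≤ n → P.ν ≠ (n : ℂ)) (hc : P.c 0 * P.c 1 = (2 * P.ν)⁻¹)
    (hq : P.PotentialClass) (lam : ℂ) (α : Fin 2 → ℂ) :
    P.IsSolution lam (fun x => P.comb α x lam) := by
  obtain ⟨s', hs, -⟩ := exists_isSolutionOn_s ha hν hν' hc hq lam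
  set y' : ℝ → ℂ := fun x => if x < P.a then α 0 * s' 0 x + α 1 * s' 1 x else
    P.A.mulVec α 0 * s' 0 x + P.A.mulVec α 1 * s' 1 x with hy'
  have hl : IsSolutionOn (P.V lam) (Set.Ico 0 P.a) (fun x => P.comb α x lam) y' :=
    (isSolutionOn_comb_left hs α).congr Set.ordConnected_Ico (fun _ _ => rfl)
      fun x hx => if_pos hx.2
  have hr : IsSolutionOn (P.V lam) (Set.Ioi P.a) (fun x => P.comb α x lam) y' :=
    (isSolutionOn_comb_right ha hs α).congr Set.ordConnected_Ioi (fun _ _ => rfl)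
      fun x hx => if_neg (not_lt.2 (le_of_lt hx))
  refine ⟨y', fun x hx => ?_, fun u v huv hd => ?_⟩
  · rcases lt_or_gt_of_ne hx.2 with h | h
    · refine hl.hasDerivWithinAt (u := 0) (v := (x + P.a) / 2) Set.ordConnected_Ico ⟨le_rfl, ha⟩
        ⟨by linarith [hx.1], by linarith⟩ ⟨hx.1, by linarith⟩ ?_
      -- The left end is exactly 0, so at x = 0 a one-sided neighbourhood suffices.
      rw [← Set.Ici_inter_Iic]
      exact inter_mem_nhdsWithin _ (Iic_mem_nhds (by linarith))
    · exact hr.hasDerivWithinAt (u := (x + P.a) / 2) (v := x + 1) Set.ordConnected_Ioi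
        (by simp only [Set.mem_Ioi]; linarith) (by simp only [Set.mem_Ioi]; linarith)
        ⟨by linarith, by linarith⟩
        (mem_nhdsWithin_of_mem_nhds (Icc_mem_nhds (by linarith) (by linarith)))
  · rcases lt_or_ge v P.a with h | h
    · exact hl.prim' u ⟨(hd ⟨le_rfl, huv⟩).1, huv.trans_lt h⟩ v ⟨(hd ⟨huv, le_rfl⟩).1, h⟩
    · have hua : P.a < u := by
        by_contra! hua
        exact (hd ⟨hua, h⟩).2 rfl
      exact hr.prim' u hua v (hua.trans_le huv)

/-- Existence of the coefficients of the Jost solution. -/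
theorem exists_jostCoeff (ha : 0 < P.a) (hν : 0 < P.ν.re)
    (hν' : ∀ n : ℕ, 1 ≤ n → P.ν ≠ (n : ℂ)) (hc : P.c 0 * P.c 1 = (2 * P.ν)⁻¹)
    (hA : P.A.det ≠ 0) (hq : P.PotentialClass) {ρ : ℂ} (hρ : ρ ≠ 0) (hρ' : 0 ≤ ρ.im) :
    ∃ α : Fin 2 → ℂ, Tendsto (fun x : ℝ => P.comb α x (ρ ^ 2) *
      Complex.exp (-(Complex.I * ρ * (x : ℂ)))) atTop (𝓝 1) := by
  obtain ⟨s', hs, hw⟩ := exists_isSolutionOn_s ha hν hν' hc hq (ρ ^ 2)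
  obtain ⟨T, hT, hQ⟩ := hq.exists_integrableOn_Q
  obtain ⟨X, hX, y, y', hy, hy1⟩ := exists_jostSolution hQ hρ hρ'
  have haX : P.a < X := hT.trans_le hX
  have hS : Set.Ioi X ⊆ P.domain := fun x hx =>
    ⟨(ha.trans (haX.trans hx)).le, (haX.trans hx).ne'⟩
  have hs0 := hs 0 _ Set.ordConnected_Ioi hS
  have hs1 := hs 1 _ Set.ordConnected_Ioi hS
  have hx₀ : X + 1 ∈ Set.Ioi X := by simp
  -- Cramer's rule: the coefficients of y in s₁, s₂ are Wronskians, constant beyond X and thus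
  -- evaluated at one point. Inverting A turns them into coefficients for σ₁, σ₂.
  let β : Fin 2 → ℂ := ![y (X + 1) * s' 1 (X + 1) - y' (X + 1) * P.s 1 (X + 1) (ρ ^ 2),
    -(y (X + 1) * s' 0 (X + 1) - y' (X + 1) * P.s 0 (X + 1) (ρ ^ 2))]
  have hβ : P.A.mulVec (P.A⁻¹.mulVec β) = β := by
    rw [Matrix.mulVec_mulVec, Matrix.mul_nonsing_inv _ (isUnit_iff_ne_zero.2 hA),
      Matrix.one_mulVec]
  refine ⟨P.A⁻¹.mulVec β, hy1.congr' ?_⟩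
  filter_upwards [eventually_gt_atTop X] with x hx
  have e0 := IsSolutionOn.wronskian_eq Set.ordConnected_Ioi hy hs0 hx₀ hx
  have e1 := IsSolutionOn.wronskian_eq Set.ordConnected_Ioi hy hs1 hx₀ hx
  have w := hw x (hS hx)
  congr 1
  rw [P.comb_of_ge _ _ (haX.trans hx).le, hβ]
  simp only [β, Matrix.cons_val_zero, Matrix.cons_val_one]
  linear_combination (-y x) * w + P.s 1 x (ρ ^ 2) * e0 - P.s 0 x (ρ ^ 2) * e1

theorem tendsto_jostCoeff (ha : 0 < P.a) (hν : 0 < P.ν.re)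
    (hν' : ∀ n : ℕ, 1 ≤ n → P.ν ≠ (n : ℂ)) (hc : P.c 0 * P.c 1 = (2 * P.ν)⁻¹)
    (hA : P.A.det ≠ 0) (hq : P.PotentialClass) {ρ : ℂ} (hρ : 0 < ρ.im) :
    Tendsto (fun x : ℝ => P.comb (P.jostCoeff ρ) x (ρ ^ 2) *
      Complex.exp (-(Complex.I * ρ * (x : ℂ)))) atTop (𝓝 1) :=
  Classical.epsilon_spec (p := fun α : Fin 2 → ℂ => Tendsto (fun x : ℝ => P.comb α x (ρ ^ 2) *
    Complex.exp (-(Complex.I * ρ * (x : ℂ)))) atTop (𝓝 1))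
    (exists_jostCoeff ha hν hν' hc hA hq (fun h => by simp [h] at hρ) hρ.le)

/-- A combination of `σ_1`, `σ_2` that vanishes at infinity is a multiple of the Jost solution. -/
theorem exists_eq_smul_of_tendsto_zero (ha : 0 < P.a) (hν : 0 < P.ν.re)
    (hν' : ∀ n : ℕ, 1 ≤ n → P.ν ≠ (n : ℂ)) (hc : P.c 0 * P.c 1 = (2 * P.ν)⁻¹)
    (hA : P.A.det ≠ 0) (hq : P.PotentialClass) {ρ : ℂ} (hρ : 0 ≤ ρ.im) {α γ : Fin 2 → ℂ}
    (hα : Tendsto (fun x => P.comb α x (ρ ^ 2)) atTop (𝓝 0))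
    (hγ : Tendsto (fun x : ℝ => P.comb γ x (ρ ^ 2) * Complex.exp (-(Complex.I * ρ * (x : ℂ))))
      atTop (𝓝 1)) : ∃ c : ℂ, α = c • γ := by
  obtain ⟨s', hs, hw⟩ := exists_isSolutionOn_s ha hν hν' hc hq (ρ ^ 2)
  obtain ⟨T, hT, hQ⟩ := hq.exists_integrableOn_Q
  have hsub : Set.Ioi T ⊆ Set.Ioi P.a := Set.Ioi_subset_Ioi hT.le
  have hx : T < T + 1 := by linarith
  have h := IsSolutionOn.wronskian_eq_zero hQ hρ ((isSolutionOn_comb_right ha hs α).mono hsub)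
    ((isSolutionOn_comb_right ha hs γ).mono hsub) hα hγ hx
  have w := hw (T + 1) ⟨by linarith, by linarith⟩
  rw [P.comb_of_ge _ _ (by linarith), P.comb_of_ge _ _ (by linarith)] at h
  simp only [Matrix.mulVec, dotProduct, Fin.sum_univ_two] at h
  -- Right of `a` the Wronskian of the two combinations is det A times the determinant of the
  -- coefficient vectors.
  have hdet : P.A.det * (α 0 * γ 1 - α 1 * γ 0) = 0 := by
    rw [Matrix.det_fin_two]
    linear_combination h - (P.A 0 0 * P.A 1 1 - P.A 0 1 * P.A 1 0) *
      (α 0 * γ 1 - α 1 * γ 0) * w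
  have hd := (mul_eq_zero.1 hdet).resolve_left hA
  by_cases h0 : γ 0 = 0
  · have h1 : γ 1 ≠ 0 := by
      intro h1
      have : (fun x : ℝ => P.comb γ x (ρ ^ 2) * Complex.exp (-(Complex.I * ρ * (x : ℂ)))) =
          fun _ => 0 := by
        funext x
        simp [comb, h0, h1]
      rw [this] at hγ
      exact zero_ne_one (tendsto_nhds_unique tendsto_const_nhds hγ)
    refine ⟨α 1 / γ 1, funext fun i => ?_⟩
    rw [h0, mul_zero, sub_zero] at hd
    fin_cases i
    · simpa [h0] using (mul_eq_zero.1 hd).resolve_right h1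
    · simp [h1]
  · refine ⟨α 0 / γ 0, funext fun i => ?_⟩
    fin_cases i
    · simp [h0]
    · simp only [Fin.mk_one, Pi.smul_apply, smul_eq_mul]
      field_simp
      linear_combination -hd

theorem exists_sq_eq_of_im_nonneg (lam : ℂ) : ∃ ρ : ℂ, 0 ≤ ρ.im ∧ lam = ρ ^ 2 := by
  obtain ⟨ρ, hρ⟩ := IsAlgClosed.exists_pow_nat_eq lam (n := 2) (by norm_num)
  rcases le_total 0 ρ.im with h | h
  · exact ⟨ρ, h, hρ.symm⟩
  · exact ⟨-ρ, by simpa using h, by rw [neg_sq, hρ]⟩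

end BesselSL

end

/-! ### Eigenvalues as zeros of the characteristic function -/

theorem theorem3 (P : BesselSL)
    (ha : 0 < P.a)
    (hν : 0 < P.ν.re)
    (hν' : ∀ n : ℕ, 1 ≤ n → P.ν ≠ (n : ℂ))
    (hc : P.c 0 * P.c 1 = (2 * P.ν)⁻¹)
    (hA : P.A.det ≠ 0)
    (hq : P.PotentialClass) :
    P.Λ' = {lam : ℂ | lam ≠ 0 ∧ P.IsEigenvalue lam} ∧
    ∀ ρ : ℂ, 0 < ρ.im → ρ ^ 2 ∈ P.Λ' →
      ∃ β : ℂ, β ≠ 0 ∧ ∀ x ∈ P.domain, P.e x ρ = β * P.φ x (ρ ^ 2) := by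
  have hjost {ρ : ℂ} (hρ : 0 < ρ.im) := BesselSL.tendsto_jostCoeff ha hν hν' hc hA hq hρ
  have hnontriv {ρ : ℂ} (hρ : 0 < ρ.im) : ∃ x ∈ P.domain, P.e x ρ ≠ 0 := by
    by_contra! h
    refine zero_ne_one (tendsto_nhds_unique (tendsto_const_nhds.congr' ?_) (hjost hρ))
    filter_upwards [eventually_gt_atTop P.a] with x hx
    have := h x ⟨(ha.trans hx).le, hx.ne'⟩
    rw [BesselSL.e] at this
    rw [this, zero_mul]
  refine ⟨Set.ext fun lam => ⟨?_, ?_⟩, ?_⟩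
  · rintro ⟨ρ, hρ, hΔ, rfl⟩
    have hρ0 : ρ ≠ 0 := fun h => by simp [h] at hρ
    refine ⟨pow_ne_zero 2 hρ0, P.jostCoeff ρ, BesselSL.isSolution_comb ha hν hν' hc hq _ _,
      hnontriv hρ, hΔ, ?_⟩
    have hdecay : Tendsto (fun x : ℝ => Complex.exp (Complex.I * ρ * x)) atTop (𝓝 0) := by
      rw [tendsto_zero_iff_norm_tendsto_zero]
      simp only [norm_exp_I_mul]
      exact Real.tendsto_exp_neg_atTop_nhds_zero.comp (tendsto_id.const_mul_atTop hρ)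
    have h := (hjost hρ).mul hdecay
    rw [mul_zero] at h
    refine h.congr fun x => ?_
    rw [mul_assoc, ← Complex.exp_add]
    simp
  · rintro ⟨h0, α, -, ⟨x, hx, hαx⟩, hα0, hα⟩
    obtain ⟨ρ, hρ, rfl⟩ := BesselSL.exists_sq_eq_of_im_nonneg lam
    have hρ0 : ρ ≠ 0 := fun h => by simp [h] at h0
    rcases hρ.eq_or_lt with hρ' | hρ'
    -- For real ρ the exponential has modulus 1, so decay of the eigenfunction forces its Jost
    -- factor c to vanish. `tendsto_jostCoeff` needs Im ρ > 0, so the coefficients are taken from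
    -- the existence statement.
    · exfalso
      obtain ⟨γ, hγ⟩ := BesselSL.exists_jostCoeff ha hν hν' hc hA hq hρ0 hρ
      obtain ⟨c, rfl⟩ := BesselSL.exists_eq_smul_of_tendsto_zero ha hν hν' hc hA hq hρ hα hγ
      have hn : Tendsto (fun x : ℝ => P.comb (c • γ) x (ρ ^ 2) *
          Complex.exp (-(Complex.I * ρ * (x : ℂ)))) atTop (𝓝 0) := by
        rw [tendsto_zero_iff_norm_tendsto_zero]
        refine (tendsto_zero_iff_norm_tendsto_zero.1 hα).congr fun x => ?_
        rw [norm_mul, Complex.exp_neg, norm_inv, norm_exp_I_mul, ← hρ']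
        simp
      have hc0 : c = 0 := by
        have h1 := hγ.const_mul c
        rw [mul_one] at h1
        refine tendsto_nhds_unique (h1.congr fun x => ?_) hn
        rw [BesselSL.comb_smul, mul_assoc c]
      exact hαx (by rw [BesselSL.comb_smul, hc0, zero_mul])
    · obtain ⟨c, rfl⟩ :=
        BesselSL.exists_eq_smul_of_tendsto_zero ha hν hν' hc hA hq hρ hα (hjost hρ')
      rw [BesselSL.comb_smul] at hαx hα0
      exact ⟨ρ, hρ', (mul_eq_zero.1 hα0).resolve_left (left_ne_zero_of_mul hαx), rfl⟩
  · rintro ρ hρ ⟨ρ', hρ', hΔ, hsq⟩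
    -- A square has only one root in the open upper half-plane.
    have hρρ : ρ = ρ' := by
      rcases sq_eq_sq_iff_eq_or_eq_neg.1 hsq with h | h
      · exact h
      · rw [h, Complex.neg_im] at hρ
        linarith
    subst hρρ
    obtain ⟨s', -, hw⟩ := BesselSL.exists_isSolutionOn_s ha hν hν' hc hq (ρ ^ 2)
    have w := hw 0 ⟨le_rfl, ha.ne⟩
    have hσ (j : Fin 2) : P.σ j 0 (ρ ^ 2) = P.s j 0 (ρ ^ 2) := if_pos ha
    have hΔ' : P.jostCoeff ρ 0 * P.σ 0 0 (ρ ^ 2) + P.jostCoeff ρ 1 * P.σ 1 0 (ρ ^ 2) = 0 := by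
      simpa [BesselSL.Δ, BesselSL.e, BesselSL.comb] using hΔ
    -- The coefficients of e annihilate the vector (σ₁(0), σ₂(0)), which is nonzero by the Wronskian
    -- at 0; such coefficients are multiples of (-σ₂(0), σ₁(0)), those of φ.
    obtain ⟨β, hβ⟩ : ∃ β, ∀ x, P.e x ρ = β * P.φ x (ρ ^ 2) := by
      by_cases h0 : P.σ 0 0 (ρ ^ 2) = 0
      · have h1 : P.σ 1 0 (ρ ^ 2) ≠ 0 := by
          intro h1
          rw [hσ] at h0 h1
          rw [h0, h1] at w
          simp at w
        refine ⟨-P.jostCoeff ρ 0 / P.σ 1 0 (ρ ^ 2), fun x => ?_⟩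
        rw [h0, mul_zero, zero_add] at hΔ'
        have h2 := (mul_eq_zero.1 hΔ').resolve_right h1
        simp only [BesselSL.e, BesselSL.comb, BesselSL.φ, Fin.sum_univ_two, h0, h2]
        field_simp
        ring
      · refine ⟨P.jostCoeff ρ 1 / P.σ 0 0 (ρ ^ 2), fun x => ?_⟩
        simp only [BesselSL.e, BesselSL.comb, BesselSL.φ, Fin.sum_univ_two]
        field_simp
        linear_combination P.σ 0 x (ρ ^ 2) * hΔ'
    refine ⟨β, fun h => ?_, fun x _ => hβ x⟩
    obtain ⟨x, -, hx⟩ := hnontriv hρ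
    exact hx (by rw [hβ, h, zero_mul])
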